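/- Let $\mathbb M=(M_p)_{p\ge 0}$ be a sequence of positive real numbers with $M_0=1$, let $m_p=M_{p+1}/M_p$, and put $\widehat{\mathbb M}=(p!\,M_p)_{p\ge 0}$. Notation. $\mathbb M$ is a weight sequence if $M_p^2\le M_{p-1}M_{p+1}$ for all $p\ge 1$ and $m_p\to\infty$. It satisfies (sm) (shifted moments) if there are $C_0>0$, $H>1$ with $\log(m_{p+1}/m_p)\le C_0H^{p+1}$ for all $p\ge 0$. The index of $\mathbb M$ is $$\gamma(\mathbb M)=\sup\{\beta>0:\ \exists a>0\ \forall\, 0\le p\le q,\ m_p/(p+1)^\beta\le a\, m_q/(q+1)^\beta\}\in[0,\infty],$$ with $\sup\emptyset=0$. For $\gamma>0$ let $S_\gamma=\{z:\ |\arg z|<\gamma\pi/2\}$, a sector of the Riemann surface of the logarithm. For $h>0$: - $\mathbb C[[z]]_{\mathbb M,h}$ is the space of formal power series $\sum_p a_pz^p$ with norm $\sup_p |a_p|/(h^pM_p)<\infty$, and $\mathbb C[[z]]_{\{\mathbb M\}}=\bigcup_{h>0}\mathbb C[[z]]_{\mathbb M,h}$. - $\widetilde{\mathcal A}^u_{\mathbb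 M,h}(S_\gamma)$ is the space of holomorphic $f:S_\gamma\to\mathbb C$ for which there is a (necessarily unique) formal power series $\widetilde{\mathcal B}(f)=\sum_p a_pz^p$ with $$\|f\|=\sup_{z\in S_\gamma,\ p\ge 0}\frac{|f(z)-\sum_{k=0}^{p-1}a_kz^k|}{h^pM_p|z|^p}<\infty,$$ normed by $\|f\|$, and $\widetilde{\mathcal A}^u_{\{\mathbb M\}}(S_\gamma)=\bigcup_{h>0}\widetilde{\mathcal A}^u_{\mathbb M,h}(S_\gamma)$. - $\mathcal A_{\widehat{\mathbb M},h}(S_\gamma)$ is the space of holomorphic $f:S_\gamma\to\mathbb C$ with $\sup_{z\in S_\gamma,\ p\ge0}|f^{(p)}(z)|/(h^p\,p!\,M_p)<\infty$, and $\mathcal A_{\{\widehat{\mathbb M}\}}(S_\gamma)=\bigcup_{h>0}\mathcal A_{\widehat{\mathbb M},h}(S_\gamma)$; on it $\widetilde{\mathcal B}(f)=\sum_p \frac{f^{(p)}(0)}{p!}z^p$, where $f^{(p)}(0)=\lim_{z\to0,\,z\in S_\gamma}f^{(p)}(z)$. - $\widetilde S^u_{\{\mathbb M\}}$, respectively $S_{\{\widehat{\mathbb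 M}\}}$, is the set of $\gamma>0$ for which $\widetilde{\mathcal B}:\widetilde{\mathcal A}^u_{\{\mathbb M\}}(S_\gamma)\to\mathbb C[[z]]_{\{\mathbb M\}}$, respectively $\widetilde{\mathcal B}:\mathcal A_{\{\widehat{\mathbb M}\}}(S_\gamma)\to\mathbb C[[z]]_{\{\mathbb M\}}$, is surjective. Theorem. Let $\mathbb M$ be a weight sequence satisfying (sm) with $\gamma(\mathbb M)>0$, and let $\gamma>0$. Then each of the following statements implies the next one: (i) $\gamma<\gamma(\mathbb M)$. (ii) There exists $c>0$ such that for every $h>0$ there is a continuous linear map $T:\mathbb C[[z]]_{\mathbb M,h}\to\widetilde{\mathcal A}^u_{\mathbb M,ch}(S_\gamma)$ such that $\widetilde{\mathcal B}\circ T$ is the identity on $\mathbb C[[z]]_{\mathbb M,h}$. (iii) The Borel map $\widetilde{\mathcal B}:\widetilde{\mathcal A}^u_{\{\mathbb M\}}(S_\gamma)\to\mathbb C[[z]]_{\{\mathbb M\}}$ is surjective; equivalently, $(0,\gamma]\subset\widetilde S^u_{\{\mathbb M\}}$. (iv) $(0,\gamma)\subset S_{\{\widehat{\mathbb M}\}}$.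 In particular, $(0,\gamma(\mathbb M))\subset S_{\{\widehat{\mathbb M}\}}\subset\widetilde S^u_{\{\mathbb M\}}$. -/

import Mathlib

open Filter Topology

namespace Ultraholomorphic

noncomputable section

/-! ### Weight sequences -/

/-- A positive real number (an opening `γ` or a type parameter `h`). -/
abbrev PosReal : Type := {x : ℝ // 0 < x}

/-- A sequence `M = (M_p)` of positive real numbers with `M_0 = 1`. -/
structure PosSeq where
  toFun : ℕ → ℝ
  pos' : ∀ p, 0 < toFun p
  zero' : toFun 0 = 1

instance : CoeFun PosSeq (fun _ => ℕ → ℝ) := ⟨PosSeq.toFun⟩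

namespace PosSeq

/-- The sequence of quotients `m_p = M_{p+1} / M_p`. -/
def quot (M : PosSeq) (p : ℕ) : ℝ := M (p + 1) / M p

/-- The sequence `(p! M_p)_p`. -/
def hat (M : PosSeq) : PosSeq where
  toFun p := (p.factorial : ℝ) * M p
  pos' p := mul_pos (by exact_mod_cast p.factorial_pos) (M.pos' p)
  zero' := by simp [M.zero']

/-- Log-convexity: `M_p ^ 2 ≤ M_{p-1} M_{p+1}` for `p ≥ 1`. -/
def LogConvex (M : PosSeq) : Prop := ∀ p, M (p + 1) ^ 2 ≤ M p * M (p + 2)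

/-- A weight sequence: log-convex, with quotients tending to infinity. -/
def IsWeightSequence (M : PosSeq) : Prop := M.LogConvex ∧ Tendsto M.quot atTop atTop

/-- The condition (sm) of shifted moments. -/
def ShiftedMoments (M : PosSeq) : Prop :=
  ∃ C₀ H : ℝ, 0 < C₀ ∧ 1 < H ∧
    ∀ p : ℕ, Real.log (M.quot (p + 1) / M.quot p) ≤ C₀ * H ^ (p + 1)

end PosSeq

/-- Almost increasing sequences. -/
def AlmostIncreasing (c : ℕ → ℝ) : Prop := ∃ a : ℝ, 0 < a ∧ ∀ p q, p ≤ q → c p ≤ a * c q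

/-- The index `γ(M) ∈ [0, ∞]`. -/
def gammaIndex (M : PosSeq) : ENNReal :=
  sSup (ENNReal.ofReal ''
    {γ : ℝ | 0 < γ ∧ AlmostIncreasing (fun p => M.quot p / ((p : ℝ) + 1) ^ γ)})

/-! ### Sectors of the Riemann surface of the logarithm -/

/-- The Riemann surface of the logarithm, i.e. the universal covering of `ℂ \ {0}`,
given through its global holomorphic coordinate `log`. -/
@[ext] structure LogSurface where
  log : ℂ

namespace LogSurface

/-- The covering map onto `ℂ \ {0}`. -/
def proj (z : LogSurface) : ℂ := Complex.exp z.log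

/-- The modulus. -/
def abs (z : LogSurface) : ℝ := Real.exp z.log.re

/-- The argument, a real number which is not reduced modulo `2π`. -/
def arg (z : LogSurface) : ℝ := z.log.im

lemma abs_pos (z : LogSurface) : 0 < z.abs := Real.exp_pos _

lemma norm_proj (z : LogSurface) : ‖z.proj‖ = z.abs := Complex.norm_exp _

end LogSurface

/-- The unbounded sector `S_γ` bisected by direction `0` and with opening `π γ`. -/
def Sector (γ : PosReal) : Set LogSurface := {z | |z.arg| < γ * Real.pi / 2}

/-- The point of `S_γ` on the positive real line with modulus `r`. -/
def Sector.ofPos (γ : PosReal) (r : ℝ) : Sector γ :=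
  ⟨⟨(Real.log r : ℂ)⟩, by
    have h : 0 < (γ : ℝ) * Real.pi / 2 := by have := γ.2; positivity
    simpa [Sector, LogSurface.arg, Complex.ofReal_im] using h⟩

lemma Sector.abs_ofPos (γ : PosReal) {r : ℝ} (hr : 0 < r) : (Sector.ofPos γ r).1.abs = r := by
  simp only [Sector.ofPos, LogSurface.abs, Complex.ofReal_re, Real.exp_log hr]

variable {γ : PosReal}

/-- A function on `S_γ`, read in the coordinate `ζ = log z` (and extended by `0`). -/
def inLog (f : Sector γ → ℂ) : ℂ → ℂ := by
  classical
  exact fun ζ => if h : (⟨ζ⟩ : LogSurface) ∈ Sector γ then f ⟨⟨ζ⟩, h⟩ else 0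

lemma inLog_apply (f : Sector γ → ℂ) (z : Sector γ) : inLog f z.1.log = f z := by
  have h : (⟨z.1.log⟩ : LogSurface) ∈ Sector γ := z.2
  unfold inLog
  exact dif_pos h

/-- The image of `S_γ` in the coordinate `log`: an open horizontal strip. -/
def logStrip (γ : PosReal) : Set ℂ := {ζ | (⟨ζ⟩ : LogSurface) ∈ Sector γ}

/-- Holomorphic functions on `S_γ`. -/
def Holomorphic (f : Sector γ → ℂ) : Prop := DifferentiableOn ℂ (inLog f) (logStrip γ)

/-- The complex derivative `f' = df/dz` on `S_γ`, where `z = exp ζ` is the local coordinate given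
by the covering map; by the chain rule `df/dz = exp(-ζ) df/dζ`. -/
def sderiv (f : Sector γ → ℂ) (z : Sector γ) : ℂ := deriv (inLog f) z.1.log / z.1.proj

/-- The `p`-th derivative `f^(p)` on `S_γ`. -/
def iterSderiv (p : ℕ) (f : Sector γ → ℂ) : Sector γ → ℂ := sderiv^[p] f

/-- The filter of `z → 0` with `z ∈ S_γ`. -/
def toVertex (γ : PosReal) : Filter (Sector γ) := comap (fun z : Sector γ => z.1.abs) (𝓝 0)

/-- `f^(p)(0)`, the limit of `f^(p)(z)` as `z → 0` in `S_γ`. -/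
def derivAtVertex (f : Sector γ → ℂ) (p : ℕ) : ℂ := limUnder (toVertex γ) (iterSderiv p f)

/-! ### Classes of formal power series -/

/-- The space `ℂ[[z]]_{M,h}`, as a submodule of `ℂ[[z]]`. -/
def formalSubmodule (M : PosSeq) (h : PosReal) : Submodule ℂ (PowerSeries ℂ) where
  carrier := {a | ∃ C : ℝ, ∀ p : ℕ, ‖PowerSeries.coeff p a‖ ≤ C * ((h : ℝ) ^ p * M p)}
  zero_mem' := ⟨0, fun p => by simp⟩
  add_mem' := by
    rintro a b ⟨C, hC⟩ ⟨D, hD⟩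
    refine ⟨C + D, fun p => ?_⟩
    rw [map_add, add_mul]
    exact (norm_add_le _ _).trans (add_le_add (hC p) (hD p))
  smul_mem' := by
    rintro c a ⟨C, hC⟩
    refine ⟨‖c‖ * C, fun p => ?_⟩
    rw [map_smul, norm_smul, mul_assoc]
    exact mul_le_mul_of_nonneg_left (hC p) (norm_nonneg c)

/-- The space `ℂ[[z]]_{M,h}`. -/
def Formal (M : PosSeq) (h : PosReal) : Type := formalSubmodule M h

instance (M : PosSeq) (h : PosReal) : AddCommGroup (Formal M h) :=
  inferInstanceAs (AddCommGroup (formalSubmodule M h))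

instance (M : PosSeq) (h : PosReal) : Module ℂ (Formal M h) :=
  inferInstanceAs (Module ℂ (formalSubmodule M h))

/-- The inclusion `ℂ[[z]]_{M,h} → ℂ[[z]]`. -/
def Formal.val {M : PosSeq} {h : PosReal} : Formal M h →ₗ[ℂ] PowerSeries ℂ :=
  (formalSubmodule M h).subtype

/-- The norm `|a|_{M,h} = sup_p |a_p| / (h^p M_p)`. -/
instance (M : PosSeq) (h : PosReal) : Norm (Formal M h) :=
  ⟨fun a => ⨆ p : ℕ, ‖PowerSeries.coeff p a.val‖ / ((h : ℝ) ^ p * M p)⟩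

/-- The class `ℂ[[z]]_{{M}}`, the union of the `ℂ[[z]]_{M,h}`, `h > 0`. -/
def formalRoumieu (M : PosSeq) : Set (PowerSeries ℂ) := ⋃ h : PosReal, formalSubmodule M h

/-! ### Uniform asymptotic expansions -/

/-- The remainder of order `p`: `f(z) - ∑_{k<p} a_k z^k`. -/
def remainder (f : Sector γ → ℂ) (a : PowerSeries ℂ) (p : ℕ) (z : Sector γ) : ℂ :=
  f z - ∑ k ∈ Finset.range p, PowerSeries.coeff k a * z.1.proj ^ k

/-- `f` admits `a` as its uniform `M`-asymptotic expansion of type `1/h` in `S_γ` (the estimates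
only; holomorphy is required separately). -/
def HasUniformExpansion (M : PosSeq) (h : PosReal) (f : Sector γ → ℂ) (a : PowerSeries ℂ) : Prop :=
  ∃ C : ℝ, 0 < C ∧ ∀ (p : ℕ) (z : Sector γ),
    ‖remainder f a p z‖ ≤ C * ((h : ℝ) ^ p * M p * z.1.abs ^ p)

lemma remainder_add (f g : Sector γ → ℂ) (a b : PowerSeries ℂ) (p : ℕ) (z : Sector γ) :
    remainder (f + g) (a + b) p z = remainder f a p z + remainder g b p z := by
  simp only [remainder, Pi.add_apply, map_add, add_mul, Finset.sum_add_distrib]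
  ring

lemma remainder_smul (c : ℂ) (f : Sector γ → ℂ) (a : PowerSeries ℂ) (p : ℕ) (z : Sector γ) :
    remainder (c • f) (c • a) p z = c * remainder f a p z := by
  simp only [remainder, Pi.smul_apply, smul_eq_mul, map_smul, mul_sub, Finset.mul_sum, mul_assoc]

lemma HasUniformExpansion.add {M : PosSeq} {h : PosReal} {f g : Sector γ → ℂ}
    {a b : PowerSeries ℂ} (hf : HasUniformExpansion M h f a) (hg : HasUniformExpansion M h g b) :
    HasUniformExpansion M h (f + g) (a + b) := by
  obtain ⟨C, hC0, hC⟩ := hf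
  obtain ⟨D, hD0, hD⟩ := hg
  refine ⟨C + D, by positivity, fun p z => ?_⟩
  rw [remainder_add, add_mul]
  exact (norm_add_le _ _).trans (add_le_add (hC p z) (hD p z))

lemma weight_pos (M : PosSeq) (h : PosReal) (p : ℕ) (z : Sector γ) :
    0 < (h : ℝ) ^ p * M p * z.1.abs ^ p := by
  have := h.2
  have := M.pos' p
  have := z.1.abs_pos
  positivity

lemma HasUniformExpansion.smul {M : PosSeq} {h : PosReal} {f : Sector γ → ℂ}
    {a : PowerSeries ℂ} (c : ℂ) (hf : HasUniformExpansion M h f a) :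
    HasUniformExpansion M h (c • f) (c • a) := by
  obtain ⟨C, hC0, hC⟩ := hf
  refine ⟨‖c‖ * C + 1, by positivity, fun p z => ?_⟩
  rw [remainder_smul, norm_mul]
  have h1 := mul_le_mul_of_nonneg_left (hC p z) (norm_nonneg c)
  have h2 := weight_pos M h p z
  nlinarith

/-- The uniform asymptotic expansion is unique. -/
lemma HasUniformExpansion.unique {M : PosSeq} {h k : PosReal} {f : Sector γ → ℂ}
    {a b : PowerSeries ℂ} (hf : HasUniformExpansion M h f a) (hg : HasUniformExpansion M k f b) :
    a = b := by
  obtain ⟨C, hC0, hC⟩ := hf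
  obtain ⟨D, hD0, hD⟩ := hg
  ext n
  induction n using Nat.strong_induction_on with
  | _ n ih =>
  set E : ℝ := C * ((h : ℝ) ^ (n + 1) * M (n + 1)) + D * ((k : ℝ) ^ (n + 1) * M (n + 1)) with hE
  have key : ∀ r : ℝ, 0 < r → ‖PowerSeries.coeff n a - PowerSeries.coeff n b‖ ≤ E * r := by
    intro r hr
    set z := Sector.ofPos γ r
    have hz : z.1.abs = r := Sector.abs_ofPos γ hr
    have h1 := hC (n + 1) z
    have h2 := hD (n + 1) z
    have h3 : remainder f b (n + 1) z - remainder f a (n + 1) z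
        = (PowerSeries.coeff n a - PowerSeries.coeff n b) * z.1.proj ^ n := by
      simp only [remainder, Finset.sum_range_succ]
      have hs : ∑ j ∈ Finset.range n, PowerSeries.coeff j a * z.1.proj ^ j
          = ∑ j ∈ Finset.range n, PowerSeries.coeff j b * z.1.proj ^ j :=
        Finset.sum_congr rfl fun j hj => by rw [ih j (Finset.mem_range.1 hj)]
      rw [hs]
      ring
    have h4 := norm_sub_le (remainder f b (n + 1) z) (remainder f a (n + 1) z)
    rw [h3, norm_mul, norm_pow, LogSurface.norm_proj, hz] at h4
    rw [hz] at h1 h2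
    have h5 : ‖PowerSeries.coeff n a - PowerSeries.coeff n b‖ * r ^ n ≤ (E * r) * r ^ n := by
      rw [hE]
      calc _ ≤ _ := h4
        _ ≤ _ := add_le_add h2 h1
        _ = _ := by ring
    exact le_of_mul_le_mul_right h5 (by positivity)
  have hlim : Tendsto (fun r : ℝ => E * r) (𝓝[>] 0) (𝓝 0) := by
    have : Tendsto (fun r : ℝ => E * r) (𝓝 0) (𝓝 (E * 0)) := (continuous_const_mul E).tendsto 0
    rw [mul_zero] at this
    exact this.mono_left nhdsWithin_le_nhds
  have h0 : ‖PowerSeries.coeff n a - PowerSeries.coeff n b‖ ≤ 0 :=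
    ge_of_tendsto hlim (eventually_nhdsWithin_of_forall fun r hr => key r hr)
  exact sub_eq_zero.1 (norm_le_zero_iff.1 h0)

/-- The asymptotic Borel map, sending a function with a uniform `M`-asymptotic expansion (of some
type) to that expansion. -/
def borel (M : PosSeq) (f : Sector γ → ℂ) : PowerSeries ℂ := by
  classical
  exact if hf : ∃ a : PowerSeries ℂ, ∃ h : PosReal, HasUniformExpansion M h f a then hf.choose else 0

lemma HasUniformExpansion.borel_eq {M : PosSeq} {h : PosReal} {f : Sector γ → ℂ}
    {a : PowerSeries ℂ} (hf : HasUniformExpansion M h f a) : borel M f = a := by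
  have hex : ∃ a : PowerSeries ℂ, ∃ h : PosReal, HasUniformExpansion M h f a := ⟨a, h, hf⟩
  have : borel M f = hex.choose := dif_pos hex
  rw [this]
  obtain ⟨k, hk⟩ := hex.choose_spec
  exact hk.unique hf

lemma inLog_add (f g : Sector γ → ℂ) : inLog (f + g) = inLog f + inLog g := by
  funext ζ
  by_cases h : (⟨ζ⟩ : LogSurface) ∈ Sector γ <;> simp [inLog, h]

lemma inLog_smul (c : ℂ) (f : Sector γ → ℂ) : inLog (c • f) = c • inLog f := by
  funext ζ
  by_cases h : (⟨ζ⟩ : LogSurface) ∈ Sector γ <;> simp [inLog, h]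

/-- The space of holomorphic functions on `S_γ` with a uniform `M`-asymptotic expansion of type
`1/h`, as a submodule of the space of all functions on `S_γ`. -/
def uniformSubmodule (M : PosSeq) (h γ : PosReal) : Submodule ℂ (Sector γ → ℂ) where
  carrier := {f | Holomorphic f ∧ ∃ a, HasUniformExpansion M h f a}
  zero_mem' := by
    refine ⟨?_, 0, 1, one_pos, fun p z => ?_⟩
    · have : inLog (0 : Sector γ → ℂ) = 0 := by funext ζ; simp [inLog]
      rw [Holomorphic, this]
      exact differentiableOn_const (0 : ℂ)
    · simpa [remainder] using (weight_pos M h p z).le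
  add_mem' := by
    rintro f g ⟨hf, a, ha⟩ ⟨hg, b, hb⟩
    refine ⟨?_, a + b, ha.add hb⟩
    rw [Holomorphic, inLog_add]
    exact DifferentiableOn.add hf hg
  smul_mem' := by
    rintro c f ⟨hf, a, ha⟩
    refine ⟨?_, c • a, ha.smul c⟩
    rw [Holomorphic, inLog_smul]
    exact DifferentiableOn.const_smul hf c

/-- The space `Ã^u_{M,h}(S_γ)`. -/
def Uniform (M : PosSeq) (h γ : PosReal) : Type := uniformSubmodule M h γ

instance (M : PosSeq) (h γ : PosReal) : AddCommGroup (Uniform M h γ) :=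
  inferInstanceAs (AddCommGroup (uniformSubmodule M h γ))

instance (M : PosSeq) (h γ : PosReal) : Module ℂ (Uniform M h γ) :=
  inferInstanceAs (Module ℂ (uniformSubmodule M h γ))

/-- The inclusion of `Ã^u_{M,h}(S_γ)` into the space of all functions on `S_γ`. -/
def Uniform.val {M : PosSeq} {h : PosReal} : Uniform M h γ →ₗ[ℂ] (Sector γ → ℂ) :=
  (uniformSubmodule M h γ).subtype

/-- The norm `sup_{z,p} |f(z) - ∑_{k<p} a_k z^k| / (h^p M_p |z|^p)`, with `∑ a_k z^k` the
asymptotic expansion of `f`. -/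
instance (M : PosSeq) (h γ : PosReal) : Norm (Uniform M h γ) :=
  ⟨fun f => ⨆ x : Sector γ × ℕ,
    ‖remainder f.val (borel M f.val) x.2 x.1‖ / ((h : ℝ) ^ x.2 * M x.2 * x.1.1.abs ^ x.2)⟩

/-- The class `Ã^u_{{M}}(S_γ)`, the union of the `Ã^u_{M,h}(S_γ)`, `h > 0`. -/
def uniformRoumieu (M : PosSeq) (γ : PosReal) : Set (Sector γ → ℂ) :=
  ⋃ h : PosReal, uniformSubmodule M h γ

/-! ### The normed space structures -/

/-- A supremum of the moduli of linear coordinates is a norm if it is finite and the coordinates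
separate points. -/
lemma core_of_iSup {E ι : Type*} [AddCommGroup E] [Module ℂ E] [Norm E] [Nonempty ι]
    (Φ : ι → E → ℂ) (hadd : ∀ i x y, Φ i (x + y) = Φ i x + Φ i y)
    (hsmul : ∀ i (c : ℂ) x, Φ i (c • x) = c * Φ i x)
    (hnorm : ∀ x, ‖x‖ = ⨆ i, ‖Φ i x‖) (hbdd : ∀ x, BddAbove (Set.range fun i => ‖Φ i x‖))
    (hinj : ∀ x, (∀ i, Φ i x = 0) → x = 0) : NormedSpace.Core ℂ E where
  norm_nonneg x := by
    rw [hnorm]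
    exact Real.iSup_nonneg fun i => norm_nonneg _
  norm_smul c x := by
    rw [hnorm, hnorm, Real.mul_iSup_of_nonneg (norm_nonneg c)]
    simp only [hsmul, norm_mul]
  norm_triangle x y := by
    rw [hnorm, hnorm, hnorm]
    refine ciSup_le fun i => ?_
    rw [hadd]
    exact (norm_add_le _ _).trans (add_le_add (le_ciSup (hbdd x) i) (le_ciSup (hbdd y) i))
  norm_eq_zero_iff x := by
    rw [hnorm]
    constructor
    · intro h
      refine hinj x fun i => ?_
      have := le_ciSup (hbdd x) i
      rw [h] at this
      exact norm_le_zero_iff.1 this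
    · rintro rfl
      have h0 : ∀ i, Φ i 0 = 0 := fun i => by simpa using hsmul i 0 0
      simp [h0]

lemma Formal.core (M : PosSeq) (h : PosReal) : NormedSpace.Core ℂ (Formal M h) := by
  have hpos : ∀ p : ℕ, 0 < (h : ℝ) ^ p * M p := fun p => mul_pos (pow_pos h.2 p) (M.pos' p)
  have hn : ∀ (p : ℕ) (w : ℂ), ‖w / (((h : ℝ) ^ p * M p : ℝ) : ℂ)‖ = ‖w‖ / ((h : ℝ) ^ p * M p) :=
    fun p w => by rw [norm_div, Complex.norm_real, Real.norm_of_nonneg (hpos p).le]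
  refine core_of_iSup
    (fun (p : ℕ) a => PowerSeries.coeff p a.val / (((h : ℝ) ^ p * M p : ℝ) : ℂ)) ?_ ?_ ?_ ?_ ?_
  · intro p a b
    rw [map_add, map_add, add_div]
  · intro p c a
    rw [map_smul, map_smul, smul_eq_mul, mul_div_assoc]
  · intro a
    simp only [hn]
    rfl
  · intro a
    obtain ⟨C, hC⟩ := a.2
    refine ⟨C, ?_⟩
    rintro _ ⟨p, rfl⟩
    simp only [hn]
    exact (div_le_iff₀ (hpos p)).2 (hC p)
  · intro a ha
    refine Subtype.ext (PowerSeries.ext fun p => ?_)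
    have h1 := ha p
    rw [div_eq_zero_iff] at h1
    rcases h1 with h1 | h1
    · exact h1
    · exact absurd (Complex.ofReal_eq_zero.1 h1) (hpos p).ne'

instance (M : PosSeq) (h : PosReal) : NormedAddCommGroup (Formal M h) :=
  NormedAddCommGroup.ofCore (Formal.core M h)

instance (M : PosSeq) (h : PosReal) : NormedSpace ℂ (Formal M h) :=
  NormedSpace.ofCore (Formal.core M h)

lemma Uniform.hasUniformExpansion {M : PosSeq} {h : PosReal} (f : Uniform M h γ) :
    HasUniformExpansion M h f.val (borel M f.val) := by
  obtain ⟨-, a, ha⟩ := f.2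
  have : borel M f.val = a := HasUniformExpansion.borel_eq ha
  rw [this]
  exact ha

lemma Uniform.core (M : PosSeq) (h γ : PosReal) : NormedSpace.Core ℂ (Uniform M h γ) := by
  have hn : ∀ (x : Sector γ × ℕ) (w : ℂ),
      ‖w / (((h : ℝ) ^ x.2 * M x.2 * x.1.1.abs ^ x.2 : ℝ) : ℂ)‖
        = ‖w‖ / ((h : ℝ) ^ x.2 * M x.2 * x.1.1.abs ^ x.2) := fun x w => by
    rw [norm_div, Complex.norm_real, Real.norm_of_nonneg (weight_pos M h x.2 x.1).le]
  have : Nonempty (Sector γ × ℕ) := ⟨(Sector.ofPos γ 1, 0)⟩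
  refine core_of_iSup (fun (x : Sector γ × ℕ) f => remainder f.val (borel M f.val) x.2 x.1
    / (((h : ℝ) ^ x.2 * M x.2 * x.1.1.abs ^ x.2 : ℝ) : ℂ)) ?_ ?_ ?_ ?_ ?_
  · intro x f g
    have : borel M (f + g).val = borel M f.val + borel M g.val := by
      rw [map_add]
      exact (f.hasUniformExpansion.add g.hasUniformExpansion).borel_eq
    simp only [this]
    rw [map_add, remainder_add, add_div]
  · intro x c f
    have : borel M (c • f).val = c • borel M f.val := by
      rw [map_smul]
      exact (f.hasUniformExpansion.smul c).borel_eq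
    simp only [this]
    rw [map_smul, remainder_smul, mul_div_assoc]
  · intro f
    simp only [hn]
    rfl
  · intro f
    obtain ⟨C, -, hC⟩ := f.hasUniformExpansion
    refine ⟨C, ?_⟩
    rintro _ ⟨x, rfl⟩
    simp only [hn]
    exact (div_le_iff₀ (weight_pos M h x.2 x.1)).2 (hC x.2 x.1)
  · intro f hf
    refine Subtype.ext (funext fun z => ?_)
    have h1 := hf (z, 0)
    simp only [remainder, Finset.range_zero, Finset.sum_empty, sub_zero, pow_zero, mul_one,
      M.zero', Complex.ofReal_one, div_one] at h1
    exact h1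

instance (M : PosSeq) (h γ : PosReal) : NormedAddCommGroup (Uniform M h γ) :=
  NormedAddCommGroup.ofCore (Uniform.core M h γ)

instance (M : PosSeq) (h γ : PosReal) : NormedSpace ℂ (Uniform M h γ) :=
  NormedSpace.ofCore (Uniform.core M h γ)

/-- `T : ℂ[[z]]_{M,h} → Ã^u_{M,k}(S_γ)`, linear and continuous for the norms above, is an
extension operator: the Borel map composed with `T` is the identity. -/
def IsExtensionOperator {M : PosSeq} {h k γ : PosReal} (T : Formal M h →L[ℂ] Uniform M k γ) :
    Prop :=
  ∀ a : Formal M h, borel M (T a).val = a.val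

/-- There is `c > 0` such that for every `h > 0` there is an extension operator from
`ℂ[[z]]_{M,h}` into `Ã^u_{M,ch}(S_γ)`. -/
def HasLocalExtensionOperators (M : PosSeq) (γ : PosReal) : Prop :=
  ∃ c : PosReal, ∀ h : PosReal,
    ∃ T : Formal M h →L[ℂ] Uniform M (c * h) γ, IsExtensionOperator T

/-! ### Ultraholomorphic classes defined through derivatives -/

/-- The class `A_{N,h}(S_γ)`. -/
def derivClass (N : PosSeq) (h γ : PosReal) : Set (Sector γ → ℂ) :=
  {f | Holomorphic f ∧
    ∃ C : ℝ, ∀ (p : ℕ) (z : Sector γ), ‖iterSderiv p f z‖ ≤ C * ((h : ℝ) ^ p * N p)}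

/-- The Carleman-Roumieu class `A_{{N}}(S_γ)`, the union of the `A_{N,h}(S_γ)`, `h > 0`. -/
def derivRoumieu (N : PosSeq) (γ : PosReal) : Set (Sector γ → ℂ) :=
  ⋃ h : PosReal, derivClass N h γ

/-- The Borel map on the classes defined through derivatives: `f ↦ ∑ f^(p)(0) / p! z^p`. -/
def taylorBorel (f : Sector γ → ℂ) : PowerSeries ℂ :=
  PowerSeries.mk fun p => derivAtVertex f p / (p.factorial : ℂ)

/-! ### Surjectivity -/

/-- The Borel map `Ã^u_{{M}}(S_γ) → ℂ[[z]]_{{M}}` is surjective. -/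
def UniformBorelSurjective (M : PosSeq) (γ : PosReal) : Prop :=
  Set.SurjOn (borel M) (uniformRoumieu M γ) (formalRoumieu M)

/-- The Borel map `A_{{M̂}}(S_γ) → ℂ[[z]]_{{M}}` is surjective, where `M̂ = (p! M_p)`. -/
def DerivBorelSurjective (M : PosSeq) (γ : PosReal) : Prop :=
  Set.SurjOn taylorBorel (derivRoumieu M.hat γ) (formalRoumieu M)

/-- The surjectivity interval of the classes `Ã^u_{{M}}`. -/
def uniformSurjInterval (M : PosSeq) : Set ℝ :=
  {γ | ∃ hγ : 0 < γ, UniformBorelSurjective M ⟨γ, hγ⟩}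

/-- The surjectivity interval of the classes `A_{{M̂}}`, where `M̂ = (p! M_p)`. -/
def derivSurjInterval (M : PosSeq) : Set ℝ :=
  {γ | ∃ hγ : 0 < γ, DerivBorelSurjective M ⟨γ, hγ⟩}

end

end Ultraholomorphic

open Ultraholomorphic

/-!
In the coordinate `ζ = log z`, the extension operators are truncated Laplace transforms of formal
Borel transforms. Fix `γ < α < β < γ(M)`. The kernel `e(z) = ∏ (1 + (z / m_p) ^ (1 / α)) ^ (-α)` is
holomorphic on `S_α`, where each factor `1 + (z / m_p) ^ (1 / α)` has modulus at least
`max 1 (|z / m_p| ^ (1 / α))`; hence `|e(z)| ≤ M_k / |z| ^ k` for every `k`. Conversely, since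
`m_p / (p + 1) ^ β` is almost increasing with `β > α`, the value `e(m_k)` is at least
`A ^ (-k) M_k / m_k ^ k`, so the `k`-th moment of `e` is at least `M_k` up to a geometric factor.
Thus dividing the coefficients of a series in `ℂ[[z]]_{M,h}` by the moments of `e` gives a
convergent series, and integrating its sum against `e(u / z) du / u` over `0 < u ≤ e ^ ρ` restores
the original series as asymptotic expansion. The remainder of order `k` is an integral of
`|e(u)| u ^ k du / u`, which is of size `M_k` for `m_{k-1} ≤ u ≤ m_k`: this costs a factor
`2 + log (m_k / m_{k-1})`, which (sm) makes geometric.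

Uniform expansions bound the derivatives on smaller sectors by Cauchy's estimates for the
remainders; bounds for all derivatives give back the expansion on the same sector by Taylor's
formula.
-/

namespace Ultraholomorphic

open MeasureTheory

variable {γ δ : PosReal}

/-! ### Differentiation in the logarithmic coordinate -/

lemma mem_logStrip {ζ : ℂ} : ζ ∈ logStrip γ ↔ |ζ.im| < γ * Real.pi / 2 := Iff.rfl

lemma isOpen_logStrip (γ : PosReal) : IsOpen (logStrip γ) :=
  isOpen_lt (continuous_abs.comp Complex.continuous_im) continuous_const

lemma logStrip_mono (h : (δ : ℝ) ≤ γ) : logStrip δ ⊆ logStrip γ := fun ζ hζ => by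
  rw [mem_logStrip] at hζ ⊢
  exact hζ.trans_le (by gcongr)

/-- The derivation `exp(-ζ) d/dζ`, which is `d/dz` in the coordinate `ζ = log z`. -/
noncomputable def expDeriv (g : ℂ → ℂ) (ζ : ℂ) : ℂ := deriv g ζ / Complex.exp ζ

section ExpDeriv

variable {U : Set ℂ} {g g₁ g₂ : ℂ → ℂ} {ζ : ℂ}

lemma eqOn_iterate_expDeriv (hU : IsOpen U) (h : Set.EqOn g₁ g₂ U) (p : ℕ) :
    Set.EqOn (expDeriv^[p] g₁) (expDeriv^[p] g₂) U := by
  induction p with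
  | zero => exact h
  | succ p ih =>
    intro ζ hζ
    rw [Function.iterate_succ_apply', Function.iterate_succ_apply', expDeriv, expDeriv,
      (ih.eventuallyEq_of_mem (hU.mem_nhds hζ)).deriv_eq]

lemma differentiableOn_iterate_expDeriv (hU : IsOpen U) (hg : DifferentiableOn ℂ g U) (p : ℕ) :
    DifferentiableOn ℂ (expDeriv^[p] g) U := by
  induction p with
  | zero => exact hg
  | succ p ih =>
    rw [Function.iterate_succ_apply']
    exact (ih.deriv hU).div Complex.differentiable_exp.differentiableOn
      fun ζ _ => Complex.exp_ne_zero ζ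

lemma hasDerivAt_iterate_expDeriv (hU : IsOpen U) (hg : DifferentiableOn ℂ g U) (p : ℕ)
    (hζ : ζ ∈ U) :
    HasDerivAt (expDeriv^[p] g) (Complex.exp ζ * expDeriv^[p + 1] g ζ) ζ := by
  have hderiv : Complex.exp ζ * expDeriv^[p + 1] g ζ = deriv (expDeriv^[p] g) ζ := by
    rw [Function.iterate_succ_apply', expDeriv, mul_div_cancel₀ _ (Complex.exp_ne_zero ζ)]
  rw [hderiv]
  exact ((differentiableOn_iterate_expDeriv hU hg p).differentiableAt (hU.mem_nhds hζ)).hasDerivAt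

lemma eqOn_iterate_expDeriv_sub (hU : IsOpen U) (h₁ : DifferentiableOn ℂ g₁ U)
    (h₂ : DifferentiableOn ℂ g₂ U) (p : ℕ) :
    Set.EqOn (expDeriv^[p] (g₁ - g₂)) (expDeriv^[p] g₁ - expDeriv^[p] g₂) U := by
  induction p with
  | zero => exact fun _ _ => rfl
  | succ p ih =>
    intro ζ hζ
    have hd₁ := hasDerivAt_iterate_expDeriv hU h₁ p hζ
    have hd₂ := hasDerivAt_iterate_expDeriv hU h₂ p hζ
    rw [Function.iterate_succ_apply', expDeriv,
      (ih.eventuallyEq_of_mem (hU.mem_nhds hζ)).deriv_eq, (hd₁.sub hd₂).deriv, ← mul_sub,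
      mul_div_cancel_left₀ _ (Complex.exp_ne_zero ζ), Pi.sub_apply]

lemma iterate_expDeriv_eval_exp (P : Polynomial ℂ) (p : ℕ) :
    expDeriv^[p] (fun ζ => P.eval (Complex.exp ζ)) =
      fun ζ => (Polynomial.derivative^[p] P).eval (Complex.exp ζ) := by
  induction p with
  | zero => rfl
  | succ p ih =>
    funext ζ
    have hderiv : HasDerivAt (fun ζ => (Polynomial.derivative^[p] P).eval (Complex.exp ζ)) _ ζ :=
      (Polynomial.hasDerivAt _ _).comp ζ (Complex.hasDerivAt_exp ζ)
    rw [Function.iterate_succ_apply', Function.iterate_succ_apply', ih, expDeriv, hderiv.deriv,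
      mul_div_cancel_right₀ _ (Complex.exp_ne_zero ζ)]

-- `w ↦ ζ + log (1 + w)` is the coordinate `log` of the point `exp ζ * (1 + w)`.
lemma mapsTo_add_log_one_add {r : ℝ} (hr : r ≤ 1 / 2) :
    Set.MapsTo (fun w => ζ + Complex.log (1 + w)) (Metric.closedBall 0 r)
      (Metric.closedBall ζ (3 / 2 * r)) := fun w hw => by
  rw [mem_closedBall_zero_iff] at hw
  rw [mem_closedBall_iff_norm, add_sub_cancel_left]
  exact (Complex.norm_log_one_add_half_le_self (hw.trans hr)).trans (by gcongr)

lemma hasDerivAt_add_log_one_add {r : ℝ} (hr : r ≤ 1 / 2) {w : ℂ}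
    (hw : w ∈ Metric.closedBall 0 r) :
    HasDerivAt (fun w => ζ + Complex.log (1 + w)) (1 + w)⁻¹ w := by
  rw [mem_closedBall_zero_iff] at hw
  have hslit : 1 + w ∈ Complex.slitPlane :=
    Complex.mem_slitPlane_of_norm_lt_one (by linarith)
  simpa using (((hasDerivAt_id w).const_add 1).clog hslit).const_add ζ

lemma eqOn_iteratedDeriv_comp_add_log_one_add (hU : IsOpen U) (hg : DifferentiableOn ℂ g U)
    {r : ℝ} (hr : r ≤ 1 / 2) (hball : Metric.closedBall ζ (3 / 2 * r) ⊆ U) (p : ℕ) :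
    Set.EqOn (iteratedDeriv p fun w => g (ζ + Complex.log (1 + w)))
      (fun w => Complex.exp ζ ^ p * expDeriv^[p] g (ζ + Complex.log (1 + w)))
      (Metric.ball 0 r) := by
  induction p with
  | zero => intro w _; simp
  | succ p ih =>
    intro w hw
    have hw' := Metric.ball_subset_closedBall hw
    have hw1 : 1 + w ≠ 0 := Complex.slitPlane_ne_zero (Complex.mem_slitPlane_of_norm_lt_one
      (by rw [mem_closedBall_zero_iff] at hw'; linarith))
    have hderiv := ((hasDerivAt_iterate_expDeriv hU hg p
      (hball (mapsTo_add_log_one_add hr hw'))).comp w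
        (hasDerivAt_add_log_one_add hr hw')).const_mul (Complex.exp ζ ^ p)
    rw [iteratedDeriv_succ, (ih.eventuallyEq_of_mem (Metric.isOpen_ball.mem_nhds hw)).deriv_eq]
    refine hderiv.deriv.trans ?_
    rw [Complex.exp_add, Complex.exp_log hw1]
    field_simp
    ring

lemma norm_iterate_expDeriv_le (hU : IsOpen U) (hg : DifferentiableOn ℂ g U) {r K : ℝ}
    (hr₀ : 0 < r) (hr : r ≤ 1 / 2) (hball : Metric.closedBall ζ (3 / 2 * r) ⊆ U)
    (hK : ∀ η ∈ Metric.closedBall ζ (3 / 2 * r), ‖g η‖ ≤ K) (p : ℕ) :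
    ‖expDeriv^[p] g ζ‖ ≤ p.factorial * K / (r * Real.exp ζ.re) ^ p := by
  have hmaps : Set.MapsTo (fun w => ζ + Complex.log (1 + w)) (Metric.closedBall 0 r) _ :=
    mapsTo_add_log_one_add hr
  have hdiff : DiffContOnCl ℂ (fun w => g (ζ + Complex.log (1 + w))) (Metric.ball 0 r) :=
    (hg.comp (fun w hw => (hasDerivAt_add_log_one_add hr
      hw).differentiableAt.differentiableWithinAt) (hmaps.mono_right hball)).diffContOnCl_ball
        subset_rfl
  have hcauchy := Complex.norm_iteratedDeriv_le_of_forall_mem_sphere_norm_le p hr₀ hdiff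
    fun w hw => hK _ (hmaps (Metric.sphere_subset_closedBall hw))
  rw [eqOn_iteratedDeriv_comp_add_log_one_add hU hg hr hball p (Metric.mem_ball_self hr₀)]
    at hcauchy
  simp only [add_zero, Complex.log_one, norm_mul, norm_pow, Complex.norm_exp] at hcauchy
  rwa [le_div_iff₀ (by positivity), mul_pow, mul_comm, mul_assoc, mul_comm,
    ← le_div_iff₀ (by positivity)]

end ExpDeriv

lemma eqOn_inLog_iterSderiv (f : Sector γ → ℂ) (p : ℕ) :
    Set.EqOn (inLog (iterSderiv p f)) (expDeriv^[p] (inLog f)) (logStrip γ) := by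
  induction p with
  | zero => exact fun _ _ => rfl
  | succ p ih =>
    intro ζ hζ
    refine (inLog_apply (iterSderiv (p + 1) f) ⟨⟨ζ⟩, hζ⟩).trans ?_
    rw [Function.iterate_succ_apply', expDeriv,
      ← (ih.eventuallyEq_of_mem ((isOpen_logStrip γ).mem_nhds hζ)).deriv_eq, iterSderiv,
      Function.iterate_succ_apply']
    rfl

lemma iterSderiv_eq (f : Sector γ → ℂ) (p : ℕ) (z : Sector γ) :
    iterSderiv p f z = expDeriv^[p] (inLog f) z.1.log := by
  rw [← eqOn_inLog_iterSderiv f p z.2, inLog_apply]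

/-! ### Restriction to smaller sectors and Cauchy estimates -/

/-- The restriction of a function on `S_γ` to a smaller sector `S_δ`. -/
def restrictSector (h : (δ : ℝ) ≤ γ) (f : Sector γ → ℂ) : Sector δ → ℂ :=
  fun z => f ⟨z.1, logStrip_mono h z.2⟩

lemma eqOn_inLog_restrictSector (h : (δ : ℝ) ≤ γ) (f : Sector γ → ℂ) :
    Set.EqOn (inLog (restrictSector h f)) (inLog f) (logStrip δ) := fun ζ hζ =>
  (inLog_apply (restrictSector h f) ⟨⟨ζ⟩, hζ⟩).trans
    (inLog_apply f ⟨⟨ζ⟩, logStrip_mono h hζ⟩).symm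

lemma Holomorphic.restrictSector (h : (δ : ℝ) ≤ γ) {f : Sector γ → ℂ} (hf : Holomorphic f) :
    Holomorphic (restrictSector h f) :=
  (DifferentiableOn.mono hf (logStrip_mono h)).congr (eqOn_inLog_restrictSector h f)

lemma HasUniformExpansion.restrictSector {M : PosSeq} {k : PosReal} (h : (δ : ℝ) ≤ γ)
    {f : Sector γ → ℂ} {a : PowerSeries ℂ} (hf : HasUniformExpansion M k f a) :
    HasUniformExpansion M k (restrictSector h f) a := by
  obtain ⟨C, hC₀, hC⟩ := hf
  exact ⟨C, hC₀, fun p z => hC p ⟨z.1, logStrip_mono h z.2⟩⟩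

lemma mem_uniformRoumieu {M : PosSeq} {f : Sector γ → ℂ} :
    f ∈ uniformRoumieu M γ ↔ Holomorphic f ∧ ∃ a h, HasUniformExpansion M h f a := by
  simp only [uniformRoumieu, Set.mem_iUnion]
  constructor
  · rintro ⟨h, hf, a, ha⟩
    exact ⟨hf, a, h, ha⟩
  · rintro ⟨hf, a, h, ha⟩
    exact ⟨h, hf, a, ha⟩

lemma UniformBorelSurjective.mono {M : PosSeq} (h : (δ : ℝ) ≤ γ)
    (hs : UniformBorelSurjective M γ) : UniformBorelSurjective M δ := by
  intro a ha
  obtain ⟨f, hf, rfl⟩ := hs ha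
  obtain ⟨hol, b, k, hb⟩ := mem_uniformRoumieu.1 hf
  rw [hb.borel_eq]
  exact ⟨restrictSector h f, mem_uniformRoumieu.2 ⟨hol.restrictSector h, b, k,
    hb.restrictSector h⟩, (hb.restrictSector h).borel_eq⟩

lemma inLog_sub_eval_trunc (f : Sector γ → ℂ) (a : PowerSeries ℂ) (n : ℕ) (z : Sector γ) :
    inLog f z.1.log - (a.trunc n).eval z.1.proj = remainder f a n z := by
  rw [inLog_apply, ← Polynomial.eval₂_id, PowerSeries.eval₂_trunc_eq_sum_range]
  rfl

lemma iterate_derivative_trunc_succ (a : PowerSeries ℂ) (p : ℕ) :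
    Polynomial.derivative^[p] (a.trunc (p + 1)) =
      Polynomial.C (p.factorial * PowerSeries.coeff p a) := by
  rw [PowerSeries.trunc_succ, iterate_map_add,
    Polynomial.iterate_derivative_eq_zero_of_degree_lt (PowerSeries.degree_trunc_lt a p), zero_add,
    ← Polynomial.C_mul_X_pow_eq_monomial, Polynomial.iterate_derivative_C_mul,
    Polynomial.iterate_derivative_X_pow_eq_C_mul, Nat.descFactorial_self, Nat.sub_self, pow_zero,
    mul_one, ← Polynomial.C_mul, mul_comm]

lemma closedBall_subset_logStrip {ζ : ℂ} (hζ : ζ ∈ logStrip δ) {R : ℝ}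
    (hR : δ * Real.pi / 2 + R ≤ γ * Real.pi / 2) : Metric.closedBall ζ R ⊆ logStrip γ :=
  fun η hη => by
    have him := (Complex.abs_im_le_norm _).trans (mem_closedBall_iff_norm.1 hη)
    rw [Complex.sub_im] at him
    rw [mem_logStrip] at hζ ⊢
    linarith [abs_sub_abs_le_abs_sub η.im ζ.im]

lemma norm_iterSderiv_restrictSector_sub_le {f : Sector γ → ℂ} (hf : Holomorphic f)
    {a : PowerSeries ℂ} {n : ℕ} {K : ℝ} (hK : ∀ z : Sector γ, ‖remainder f a n z‖ ≤ K * z.1.abs ^ n)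
    {r : ℝ} (hr₀ : 0 < r) (hr : r ≤ 1 / 2) (h : (δ : ℝ) ≤ γ)
    (hgap : δ * Real.pi / 2 + 3 / 2 * r ≤ γ * Real.pi / 2) (p : ℕ) (z : Sector δ) :
    ‖iterSderiv p (restrictSector h f) z -
        (Polynomial.derivative^[p] (a.trunc n)).eval z.1.proj‖
      ≤ p.factorial * (K * (Real.exp 1 * z.1.abs) ^ n) / (r * z.1.abs) ^ p := by
  have hK₀ : 0 ≤ K := by
    have hz := z.1.abs_pos
    exact nonneg_of_mul_nonneg_left ((norm_nonneg _).trans (hK ⟨z.1, logStrip_mono h z.2⟩))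
      (by positivity)
  have hball : Metric.closedBall z.1.log (3 / 2 * r) ⊆ logStrip γ :=
    closedBall_subset_logStrip z.2 hgap
  have hP : DifferentiableOn ℂ (fun ζ => (a.trunc n).eval (Complex.exp ζ)) (logStrip γ) :=
    ((a.trunc n).differentiable.comp Complex.differentiable_exp).differentiableOn
  have hbound : ∀ η ∈ Metric.closedBall z.1.log (3 / 2 * r),
      ‖(inLog f - fun ζ => (a.trunc n).eval (Complex.exp ζ)) η‖
        ≤ K * (Real.exp 1 * z.1.abs) ^ n := fun η hη => by
    have hre := (Complex.re_le_norm _).trans (mem_closedBall_iff_norm.1 hη)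
    rw [Complex.sub_re] at hre
    have habs : LogSurface.abs ⟨η⟩ ≤ Real.exp 1 * z.1.abs := by
      rw [LogSurface.abs, LogSurface.abs, ← Real.exp_add]
      exact Real.exp_le_exp.2 (by linarith)
    calc ‖(inLog f - fun ζ => (a.trunc n).eval (Complex.exp ζ)) η‖
        = ‖remainder f a n ⟨⟨η⟩, hball hη⟩‖ := by rw [← inLog_sub_eval_trunc]; rfl
      _ ≤ K * LogSurface.abs ⟨η⟩ ^ n := hK _
      _ ≤ K * (Real.exp 1 * z.1.abs) ^ n := by
        have := LogSurface.abs_pos ⟨η⟩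
        gcongr
  have hcauchy := norm_iterate_expDeriv_le (isOpen_logStrip γ) (DifferentiableOn.sub hf hP) hr₀ hr
    hball hbound p
  rwa [eqOn_iterate_expDeriv_sub (isOpen_logStrip γ) hf hP p (logStrip_mono h z.2), Pi.sub_apply,
    iterate_expDeriv_eval_exp, ← eqOn_iterate_expDeriv (isOpen_logStrip δ)
      (eqOn_inLog_restrictSector h f) p z.2, ← iterSderiv_eq] at hcauchy

lemma toVertex_neBot (γ : PosReal) : (toVertex γ).NeBot := by
  refine comap_neBot fun t ht => ?_
  obtain ⟨ε, hε, hεt⟩ := Metric.mem_nhds_iff.1 ht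
  refine ⟨Sector.ofPos γ (ε / 2), hεt ?_⟩
  rw [Sector.abs_ofPos γ (by positivity), Metric.mem_ball, Real.dist_0_eq_abs,
    abs_of_pos (by positivity)]
  linarith

lemma tendsto_abs_toVertex (γ : PosReal) :
    Tendsto (fun z : Sector γ => z.1.abs) (toVertex γ) (𝓝 0) := tendsto_comap

lemma taylorBorel_eq {f : Sector γ → ℂ} {a : PowerSeries ℂ}
    (h : ∀ p, Tendsto (iterSderiv p f) (toVertex γ) (𝓝 (p.factorial * PowerSeries.coeff p a))) :
    taylorBorel f = a := by
  have := toVertex_neBot γ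
  ext p
  rw [taylorBorel, PowerSeries.coeff_mk, derivAtVertex, (h p).limUnder_eq,
    mul_div_cancel_left₀ _ (by exact_mod_cast p.factorial_ne_zero)]

section CauchyEstimates

variable {M : PosSeq} {k : PosReal} {f : Sector γ → ℂ} {a : PowerSeries ℂ}

lemma exists_radius_of_lt (h : (δ : ℝ) < γ) :
    ∃ r : ℝ, 0 < r ∧ r ≤ 1 / 2 ∧ δ * Real.pi / 2 + 3 / 2 * r ≤ γ * Real.pi / 2 := by
  have : 0 < ((γ : ℝ) - δ) * Real.pi := mul_pos (sub_pos.2 h) Real.pi_pos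
  refine ⟨min (1 / 2) ((γ - δ) * Real.pi / 3), by positivity, min_le_left _ _, ?_⟩
  linarith [min_le_right (1 / 2) (((γ : ℝ) - δ) * Real.pi / 3)]

lemma HasUniformExpansion.restrictSector_mem_derivRoumieu (hf : Holomorphic f)
    (ha : HasUniformExpansion M k f a) (h : (δ : ℝ) < γ) :
    Ultraholomorphic.restrictSector h.le f ∈ derivRoumieu M.hat δ := by
  obtain ⟨C, -, hC⟩ := ha
  obtain ⟨r, hr₀, hr, hgap⟩ := exists_radius_of_lt h
  have hk := k.2
  refine Set.mem_iUnion.2 ⟨⟨k * Real.exp 1 / r, by positivity⟩, hf.restrictSector h.le, C,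
    fun p z => ?_⟩
  have hcauchy := norm_iterSderiv_restrictSector_sub_le hf
    (fun z => (hC p z).trans_eq (mul_assoc _ _ _).symm) hr₀ hr h.le hgap p z
  rw [Polynomial.iterate_derivative_eq_zero_of_degree_lt (PowerSeries.degree_trunc_lt a p),
    Polynomial.eval_zero, sub_zero] at hcauchy
  refine hcauchy.trans_eq ?_
  have hz := z.1.abs_pos
  simp only [PosSeq.hat, div_pow, mul_pow]
  field_simp

lemma HasUniformExpansion.tendsto_iterSderiv_restrictSector (hf : Holomorphic f)
    (ha : HasUniformExpansion M k f a) (h : (δ : ℝ) < γ) (p : ℕ) :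
    Tendsto (iterSderiv p (Ultraholomorphic.restrictSector h.le f)) (toVertex δ)
      (𝓝 (p.factorial * PowerSeries.coeff p a)) := by
  obtain ⟨C, -, hC⟩ := ha
  obtain ⟨r, hr₀, hr, hgap⟩ := exists_radius_of_lt h
  have hbound : ∀ z : Sector δ, ‖iterSderiv p (Ultraholomorphic.restrictSector h.le f) z -
      p.factorial * PowerSeries.coeff p a‖
        ≤ p.factorial * (C * (k ^ (p + 1) * M (p + 1))) * Real.exp 1 ^ (p + 1) / r ^ p
          * z.1.abs := fun z => by
    have hcauchy := norm_iterSderiv_restrictSector_sub_le hf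
      (fun z => (hC (p + 1) z).trans_eq (mul_assoc _ _ _).symm) hr₀ hr h.le hgap p z
    rw [iterate_derivative_trunc_succ, Polynomial.eval_C] at hcauchy
    refine hcauchy.trans_eq ?_
    have hz := z.1.abs_pos
    simp only [mul_pow, pow_succ z.1.abs]
    field_simp
  rw [tendsto_iff_norm_sub_tendsto_zero]
  refine squeeze_zero (fun _ => norm_nonneg _) hbound ?_
  simpa only [mul_zero] using (tendsto_abs_toVertex δ).const_mul
    (p.factorial * (C * (k ^ (p + 1) * M (p + 1))) * Real.exp 1 ^ (p + 1) / r ^ p)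

end CauchyEstimates

lemma UniformBorelSurjective.deriv {M : PosSeq} (h : (δ : ℝ) < γ)
    (hs : UniformBorelSurjective M γ) : DerivBorelSurjective M δ := by
  intro a ha
  obtain ⟨f, hf, rfl⟩ := hs ha
  obtain ⟨hol, a, k, hexp⟩ := mem_uniformRoumieu.1 hf
  rw [hexp.borel_eq]
  exact ⟨restrictSector h.le f, hexp.restrictSector_mem_derivRoumieu hol h,
    taylorBorel_eq (hexp.tendsto_iterSderiv_restrictSector hol h)⟩

/-! ### Taylor's formula at the vertex -/

lemma convex_logStrip (γ : PosReal) : Convex ℝ (logStrip γ) := by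
  have h : logStrip γ = {ζ | -(γ * Real.pi / 2) < ζ.im} ∩ {ζ | ζ.im < γ * Real.pi / 2} := by
    ext ζ
    rw [mem_logStrip, abs_lt]
    rfl
  rw [h]
  exact (convex_halfSpace_im_gt _).inter (convex_halfSpace_im_lt _)

lemma add_ofReal_mem_logStrip {ζ : ℂ} (hζ : ζ ∈ logStrip γ) (t : ℝ) : ζ + t ∈ logStrip γ := by
  rw [mem_logStrip] at hζ ⊢
  rwa [Complex.add_im, Complex.ofReal_im, add_zero]

lemma ofReal_mem_logStrip (γ : PosReal) (x : ℝ) : (x : ℂ) ∈ logStrip γ := by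
  have := γ.2
  rw [mem_logStrip, Complex.ofReal_im, abs_zero]
  positivity

lemma tendsto_re_log_toVertex (γ : PosReal) :
    Tendsto (fun z : Sector γ => z.1.log.re) (toVertex γ) atBot :=
  Real.tendsto_exp_comp_nhds_zero.1 (tendsto_abs_toVertex γ)

lemma tendsto_ray_toVertex {ζ : ℂ} (hζ : ζ ∈ logStrip γ) :
    Tendsto (fun t : ℝ => (⟨⟨ζ + t⟩, add_ofReal_mem_logStrip hζ t⟩ : Sector γ)) atBot
      (toVertex γ) := by
  refine tendsto_comap_iff.2 (Real.tendsto_exp_comp_nhds_zero.2 ?_)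
  simpa using tendsto_atBot_add_const_left atBot ζ.re tendsto_id

section ExponentialDecay

variable {u u' : ℝ → ℂ} {K c : ℝ}

lemma integrableOn_Iic_of_norm_deriv_le_exp (hc : 0 < c) (hu : ∀ x, HasDerivAt u (u' x) x)
    (hK : ∀ x, ‖u' x‖ ≤ K * Real.exp (c * x)) (y : ℝ) : IntegrableOn u' (Set.Iic y) := by
  have hderiv : u' = deriv u := funext fun x => (hu x).deriv.symm
  refine ((integrableOn_exp_mul_Iic hc y).const_mul K).mono' ?_ (Eventually.of_forall hK)
  rw [hderiv]
  exact (stronglyMeasurable_deriv u).aestronglyMeasurable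

lemma norm_sub_le_of_tendsto_atBot {l : ℂ} (hc : 0 < c) (hu : ∀ x, HasDerivAt u (u' x) x)
    (hK : ∀ x, ‖u' x‖ ≤ K * Real.exp (c * x)) (hl : Tendsto u atBot (𝓝 l)) (y : ℝ) :
    ‖u y - l‖ ≤ K * (Real.exp (c * y) / c) := by
  rw [← integral_Iic_of_hasDerivAt_of_tendsto' (fun x _ => hu x)
    (integrableOn_Iic_of_norm_deriv_le_exp hc hu hK y) hl, ← integral_exp_mul_Iic hc y,
    ← integral_const_mul]
  exact norm_integral_le_of_norm_le ((integrableOn_exp_mul_Iic hc y).const_mul K)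
    (Eventually.of_forall hK)

end ExponentialDecay

section Taylor

variable {g g' : ℂ → ℂ}

lemma norm_sub_ofReal_re_le {K : ℝ}
    (hg : ∀ ζ ∈ logStrip γ, HasDerivAt g (Complex.exp ζ * g' ζ) ζ)
    (hK : ∀ ζ ∈ logStrip γ, ‖g' ζ‖ ≤ K) {ζ : ℂ} (hζ : ζ ∈ logStrip γ) :
    ‖g ζ - g (ζ.re : ℂ)‖ ≤ K * (γ * Real.pi / 2) * Real.exp ζ.re := by
  have hK₀ : 0 ≤ K := (norm_nonneg _).trans (hK ζ hζ)
  have hconv : Convex ℝ (logStrip γ ∩ {η | η.re = ζ.re}) :=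
    (convex_logStrip γ).inter (convex_hyperplane Complex.reLm.isLinear _)
  have hmean := hconv.norm_image_sub_le_of_norm_hasDerivWithin_le
    (fun η hη => (hg η hη.1).hasDerivWithinAt)
    (fun η hη => by
      rw [norm_mul, Complex.norm_exp, hη.2]
      exact mul_le_mul_of_nonneg_left (hK η hη.1) (Real.exp_pos _).le)
    (x := (ζ.re : ℂ)) ⟨ofReal_mem_logStrip γ _, Complex.ofReal_re _⟩ ⟨hζ, rfl⟩
  have hdist : ‖ζ - (ζ.re : ℂ)‖ ≤ γ * Real.pi / 2 := by
    rw [show ζ - (ζ.re : ℂ) = ζ.im * Complex.I by apply Complex.ext <;> simp, norm_mul,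
      Complex.norm_I, mul_one, Complex.norm_real]
    exact (mem_logStrip.1 hζ).le
  calc ‖g ζ - g (ζ.re : ℂ)‖ ≤ Real.exp ζ.re * K * ‖ζ - (ζ.re : ℂ)‖ := hmean
    _ ≤ Real.exp ζ.re * K * (γ * Real.pi / 2) := by gcongr
    _ = K * (γ * Real.pi / 2) * Real.exp ζ.re := by ring

lemma exists_tendsto_toVertex {K : ℝ}
    (hg : ∀ ζ ∈ logStrip γ, HasDerivAt g (Complex.exp ζ * g' ζ) ζ)
    (hK : ∀ ζ ∈ logStrip γ, ‖g' ζ‖ ≤ K) :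
    ∃ l : ℂ, Tendsto (fun z : Sector γ => g z.1.log) (toVertex γ) (𝓝 l) := by
  have hderiv : ∀ x : ℝ, HasDerivAt (fun x : ℝ => g x) (Complex.exp x * g' x) x := fun x =>
    (hg x (ofReal_mem_logStrip γ x)).comp_ofReal
  have hbound : ∀ x : ℝ, ‖Complex.exp x * g' x‖ ≤ K * Real.exp (1 * x) := fun x => by
    rw [norm_mul, Complex.norm_exp, Complex.ofReal_re, one_mul, mul_comm]
    exact mul_le_mul_of_nonneg_right (hK x (ofReal_mem_logStrip γ x)) (Real.exp_pos x).le
  have hreal := (tendsto_limUnder_of_hasDerivAt_of_integrableOn_Iic (fun x _ => hderiv x)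
    (integrableOn_Iic_of_norm_deriv_le_exp one_pos hderiv hbound 0)).comp
      (tendsto_re_log_toVertex γ)
  have hvert : Tendsto (fun z : Sector γ => g z.1.log - g (z.1.log.re : ℂ)) (toVertex γ)
      (𝓝 0) := by
    have hmodulus := (tendsto_abs_toVertex γ).const_mul (K * (γ * Real.pi / 2))
    rw [mul_zero] at hmodulus
    exact squeeze_zero_norm (fun z => norm_sub_ofReal_re_le hg hK z.2) hmodulus
  exact ⟨_, by simpa only [Function.comp_apply, sub_add_cancel] using hvert.add hreal⟩

lemma norm_sub_eval_exp_le_of_derivative {P : Polynomial ℂ} {C : ℝ} {n : ℕ}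
    (hg : ∀ ζ ∈ logStrip γ, HasDerivAt g (Complex.exp ζ * g' ζ) ζ)
    (hlim : Tendsto (fun z : Sector γ => g z.1.log) (toVertex γ) (𝓝 (P.eval 0)))
    (hC : ∀ ζ ∈ logStrip γ, ‖g' ζ - P.derivative.eval (Complex.exp ζ)‖ ≤ C * Real.exp ζ.re ^ n)
    {ζ : ℂ} (hζ : ζ ∈ logStrip γ) :
    ‖g ζ - P.eval (Complex.exp ζ)‖ ≤ C / (n + 1) * Real.exp ζ.re ^ (n + 1) := by
  have hderiv : ∀ t : ℝ, HasDerivAt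
      (fun t : ℝ => g (ζ + t) - P.eval (Complex.exp (ζ + t)))
      (Complex.exp (ζ + t) * (g' (ζ + t) - P.derivative.eval (Complex.exp (ζ + t)))) t := by
    intro t
    have hPexp : HasDerivAt (fun η => P.eval (Complex.exp η)) _ (ζ + t) :=
      (P.hasDerivAt _).comp (ζ + t : ℂ) (Complex.hasDerivAt_exp _)
    convert! (((hg _ (add_ofReal_mem_logStrip hζ t)).sub hPexp).comp_const_add ζ
      (t : ℂ)).comp_ofReal using 1
    ring
  have hbound : ∀ t : ℝ,
      ‖Complex.exp (ζ + t) * (g' (ζ + t) - P.derivative.eval (Complex.exp (ζ + t)))‖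
        ≤ C * Real.exp ζ.re ^ (n + 1) * Real.exp ((n + 1) * t) := by
    intro t
    rw [norm_mul, Complex.norm_exp]
    refine (mul_le_mul_of_nonneg_left (hC _ (add_ofReal_mem_logStrip hζ t))
      (Real.exp_pos _).le).trans_eq ?_
    rw [Complex.add_re, Complex.ofReal_re, Real.exp_add, ← Nat.cast_add_one,
      Real.exp_nat_mul]
    ring
  have hvertex : Tendsto (fun t : ℝ => g (ζ + t) - P.eval (Complex.exp (ζ + t))) atBot (𝓝 0) := by
    have hexp : Tendsto (fun t : ℝ => Complex.exp (ζ + t)) atBot (𝓝 0) := by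
      rw [tendsto_zero_iff_norm_tendsto_zero]
      simp only [Complex.norm_exp]
      exact (tendsto_abs_toVertex γ).comp (tendsto_ray_toVertex hζ)
    rw [← sub_self (P.eval 0)]
    exact (hlim.comp (tendsto_ray_toVertex hζ)).sub ((P.continuous.tendsto 0).comp hexp)
  have hdecay := norm_sub_le_of_tendsto_atBot (by positivity) hderiv hbound hvertex 0
  simp only [Complex.ofReal_zero, add_zero, sub_zero, mul_zero, Real.exp_zero] at hdecay
  exact hdecay.trans_eq (by ring)

lemma norm_sub_eval_trunc_exp_le {g : ℕ → ℂ → ℂ} {B : ℕ → ℝ} {a : PowerSeries ℂ}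
    (hg : ∀ p, ∀ ζ ∈ logStrip γ, HasDerivAt (g p) (Complex.exp ζ * g (p + 1) ζ) ζ)
    (hB : ∀ p, ∀ ζ ∈ logStrip γ, ‖g p ζ‖ ≤ B p)
    (hlim : ∀ p, Tendsto (fun z : Sector γ => g p z.1.log) (toVertex γ)
      (𝓝 (p.factorial * PowerSeries.coeff p a))) (n : ℕ) {ζ : ℂ} (hζ : ζ ∈ logStrip γ) :
    ‖g 0 ζ - (a.trunc n).eval (Complex.exp ζ)‖ ≤ B n / n.factorial * Real.exp ζ.re ^ n := by
  induction n generalizing g B a ζ with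
  | zero => simpa using hB 0 ζ hζ
  | succ n ih =>
    have hlim' : ∀ p, Tendsto (fun z : Sector γ => g (p + 1) z.1.log) (toVertex γ)
        (𝓝 (p.factorial * PowerSeries.coeff p (PowerSeries.derivative ℂ a))) := fun p => by
      convert! hlim (p + 1) using 2
      rw [PowerSeries.coeff_derivative, Nat.factorial_succ]
      push_cast
      ring
    have hlim₀ : Tendsto (fun z : Sector γ => g 0 z.1.log) (toVertex γ)
        (𝓝 ((a.trunc (n + 1)).eval 0)) := by
      rw [← Polynomial.coeff_zero_eq_eval_zero, PowerSeries.coeff_trunc, if_pos n.succ_pos]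
      simpa using hlim 0
    refine (norm_sub_eval_exp_le_of_derivative (C := B (n + 1) / n.factorial) (n := n)
      (hg 0) hlim₀ (fun η hη => ?_) hζ).trans_eq ?_
    · rw [← PowerSeries.trunc_derivative]
      exact ih (fun p => hg (p + 1)) (fun p => hB (p + 1)) hlim' hη
    · rw [div_div, Nat.factorial_succ]
      push_cast
      rw [mul_comm (n.factorial : ℝ)]

end Taylor

lemma DerivBorelSurjective.uniform {M : PosSeq} (hs : DerivBorelSurjective M γ) :
    UniformBorelSurjective M γ := by
  intro a ha
  obtain ⟨f, hf, rfl⟩ := hs ha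
  obtain ⟨h, hol, C, hC⟩ := Set.mem_iUnion.1 hf
  have hderiv : ∀ p, ∀ ζ ∈ logStrip γ, HasDerivAt (expDeriv^[p] (inLog f)) _ ζ := fun p ζ hζ =>
    hasDerivAt_iterate_expDeriv (isOpen_logStrip γ) hol p hζ
  have hbound : ∀ p, ∀ ζ ∈ logStrip γ,
      ‖expDeriv^[p] (inLog f) ζ‖ ≤ (|C| + 1) * (h ^ p * M.hat p) := fun p ζ hζ => by
    have hweight : 0 < (h : ℝ) ^ p * M.hat p := mul_pos (pow_pos h.2 p) (M.hat.pos' p)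
    have hCp := hC p ⟨⟨ζ⟩, hζ⟩
    rw [iterSderiv_eq] at hCp
    exact hCp.trans (mul_le_mul_of_nonneg_right (by linarith [le_abs_self C]) hweight.le)
  have hlim : ∀ p, Tendsto (fun z : Sector γ => expDeriv^[p] (inLog f) z.1.log) (toVertex γ)
      (𝓝 (p.factorial * PowerSeries.coeff p (taylorBorel f))) := fun p => by
    have hiter : iterSderiv p f = fun z : Sector γ => expDeriv^[p] (inLog f) z.1.log :=
      funext (iterSderiv_eq f p)
    rw [taylorBorel, PowerSeries.coeff_mk, mul_div_cancel₀ _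
      (by exact_mod_cast p.factorial_ne_zero), derivAtVertex, hiter]
    exact tendsto_nhds_limUnder (exists_tendsto_toVertex (hderiv p) (hbound (p + 1)))
  have hexp : HasUniformExpansion M h f (taylorBorel f) := by
    refine ⟨|C| + 1, by positivity, fun p z => ?_⟩
    rw [← inLog_sub_eval_trunc]
    refine (norm_sub_eval_trunc_exp_le hderiv hbound hlim p z.2).trans_eq ?_
    have hp : (p.factorial : ℝ) ≠ 0 := by exact_mod_cast p.factorial_ne_zero
    simp only [PosSeq.hat, LogSurface.abs]
    field_simp
  exact ⟨f, mem_uniformRoumieu.2 ⟨hol, _, h, hexp⟩, hexp.borel_eq⟩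

/-! ### The kernel -/

section RightHalfPlane

variable {w : ℂ}

lemma one_le_re_one_add (hw : 0 ≤ w.re) : 1 ≤ (1 + w).re := by
  rw [Complex.add_re, Complex.one_re]
  exact le_add_of_nonneg_right hw

lemma one_add_mem_slitPlane (hw : 0 ≤ w.re) : 1 + w ∈ Complex.slitPlane :=
  Or.inl (one_pos.trans_le (one_le_re_one_add hw))

lemma one_le_norm_one_add (hw : 0 ≤ w.re) : 1 ≤ ‖1 + w‖ :=
  (one_le_re_one_add hw).trans (Complex.re_le_norm _)

lemma norm_le_norm_one_add (hw : 0 ≤ w.re) : ‖w‖ ≤ ‖1 + w‖ := by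
  rw [← sq_le_sq₀ (norm_nonneg _) (norm_nonneg _), Complex.sq_norm, Complex.sq_norm,
    Complex.normSq_add, Complex.normSq_one, one_mul, Complex.conj_re]
  linarith

lemma norm_log_one_add_le_of_re_nonneg (hw : 0 ≤ w.re) : ‖Complex.log (1 + w)‖ ≤ ‖w‖ := by
  have hmean := (convex_halfSpace_re_ge 0).norm_image_sub_le_of_norm_hasDerivWithin_le
    (f := fun v : ℂ => Complex.log (1 + v)) (f' := fun v => 1 / (1 + v)) (C := 1)
    (fun v hv => (((hasDerivAt_id v).const_add 1).clog
      (one_add_mem_slitPlane hv)).hasDerivWithinAt)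
    (fun v hv => by
      rw [norm_div, norm_one]
      exact div_le_one_of_le₀ (one_le_norm_one_add hv) (norm_nonneg _))
    (show (0 : ℝ) ≤ (0 : ℂ).re from le_rfl) hw
  simpa only [add_zero, Complex.log_one, sub_zero, one_mul] using hmean

lemma max_log_norm_le_re_log_one_add (hw : 0 ≤ w.re) (hw₀ : w ≠ 0) :
    max 0 (Real.log ‖w‖) ≤ (Complex.log (1 + w)).re := by
  rw [Complex.log_re]
  exact max_le (Real.log_nonneg (one_le_norm_one_add hw))
    (Real.log_le_log (norm_pos_iff.2 hw₀) (norm_le_norm_one_add hw))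

end RightHalfPlane

/-- The variable `(z / m) ^ (1 / α)`, where `ζ = log z` and `l = log m`. -/
noncomputable def kernelVar (α : PosReal) (l : ℝ) (ζ : ℂ) : ℂ :=
  Complex.exp ((ζ - l) / (α : ℝ))

/-- The kernel `∏ (1 + (z / m_p) ^ (1 / α)) ^ (-α)`, where `ζ = log z` and `ℓ p = log m_p`. -/
noncomputable def kernel (α : PosReal) (ℓ : ℕ → ℝ) (ζ : ℂ) : ℂ :=
  Complex.exp (-(α : ℝ) * ∑' p, Complex.log (1 + kernelVar α (ℓ p) ζ))

/-- The restriction of the kernel to the positive half-line, in the coordinate `s = log z`. -/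
noncomputable def realKernel (α : PosReal) (ℓ : ℕ → ℝ) (s : ℝ) : ℝ :=
  Real.exp (-α * ∑' p, Real.log (1 + Real.exp ((s - ℓ p) / α)))

/-- The partial sums `log (m_0 ⋯ m_{k-1}) = log M_k`, where `ℓ p = log m_p`. -/
noncomputable def logSum (ℓ : ℕ → ℝ) (k : ℕ) : ℝ := ∑ p ∈ Finset.range k, ℓ p

section Kernel

variable {α : PosReal} {ℓ : ℕ → ℝ}

lemma logSum_succ (ℓ : ℕ → ℝ) (k : ℕ) : logSum ℓ (k + 1) = logSum ℓ k + ℓ k :=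
  Finset.sum_range_succ ℓ k

lemma sum_range_sub_div (x : ℝ) (ℓ : ℕ → ℝ) (k : ℕ) :
    ∑ p ∈ Finset.range k, (x - ℓ p) / α = (k * x - logSum ℓ k) / α := by
  rw [← Finset.sum_div, Finset.sum_sub_distrib, Finset.sum_const, Finset.card_range,
    nsmul_eq_mul, logSum]

lemma norm_kernelVar (l : ℝ) (ζ : ℂ) : ‖kernelVar α l ζ‖ = Real.exp ((ζ.re - l) / α) := by
  rw [kernelVar, Complex.norm_exp, Complex.div_ofReal_re, Complex.sub_re, Complex.ofReal_re]

lemma differentiable_kernelVar (l : ℝ) : Differentiable ℂ (kernelVar α l) := by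
  unfold kernelVar
  fun_prop

lemma kernelVar_re_pos (l : ℝ) {ζ : ℂ} (hζ : ζ ∈ logStrip α) : 0 < (kernelVar α l ζ).re := by
  have hα := α.2
  obtain ⟨hlower, hupper⟩ := abs_lt.1 (mem_logStrip.1 hζ)
  rw [kernelVar, Complex.exp_re, Complex.div_ofReal_im, Complex.sub_im, Complex.ofReal_im, sub_zero]
  refine mul_pos (Real.exp_pos _) (Real.cos_pos_of_mem_Ioo ⟨?_, ?_⟩)
  · rw [lt_div_iff₀ hα]
    linarith
  · rw [div_lt_iff₀ hα]
    linarith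

lemma exp_sub_div (s l : ℝ) : Real.exp ((s - l) / α) = Real.exp (s / α) * Real.exp (-l / α) := by
  rw [← Real.exp_add]
  ring_nf

lemma norm_log_one_add_kernelVar_le (p : ℕ) {ζ : ℂ} (hζ : ζ ∈ logStrip α) :
    ‖Complex.log (1 + kernelVar α (ℓ p) ζ)‖ ≤ Real.exp (ζ.re / α) * Real.exp (-ℓ p / α) := by
  rw [← exp_sub_div, ← norm_kernelVar]
  exact norm_log_one_add_le_of_re_nonneg (kernelVar_re_pos _ hζ).le

lemma summable_log_one_add_kernelVar (hsum : Summable fun p => Real.exp (-ℓ p / α)) {ζ : ℂ}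
    (hζ : ζ ∈ logStrip α) : Summable fun p => Complex.log (1 + kernelVar α (ℓ p) ζ) :=
  Summable.of_norm_bounded (hsum.mul_left _) fun p => norm_log_one_add_kernelVar_le p hζ

lemma differentiableOn_kernel (hsum : Summable fun p => Real.exp (-ℓ p / α)) :
    DifferentiableOn ℂ (kernel α ℓ) (logStrip α) := by
  intro ζ hζ
  have hα := α.2
  set U : Set ℂ := logStrip α ∩ {η | η.re < ζ.re + 1}
  have hU : IsOpen U :=
    (isOpen_logStrip α).inter (isOpen_lt Complex.continuous_re continuous_const)
  have hlog : DifferentiableOn ℂ (fun η => ∑' p, Complex.log (1 + kernelVar α (ℓ p) η)) U := by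
    refine Complex.differentiableOn_tsum_of_summable_norm
      (hsum.mul_left (Real.exp ((ζ.re + 1) / α))) (fun p η hη => ?_) hU fun p η hη => ?_
    · exact (((differentiable_kernelVar (ℓ p) η).const_add 1).clog
        (one_add_mem_slitPlane (kernelVar_re_pos (ℓ p) hη.1).le)).differentiableWithinAt
    · have hre : η.re < ζ.re + 1 := hη.2
      refine (norm_log_one_add_kernelVar_le p hη.1).trans ?_
      gcongr
  have hζU : U ∈ 𝓝 ζ := hU.mem_nhds ⟨hζ, lt_add_one ζ.re⟩
  exact ((hlog.differentiableAt hζU).const_mul _).cexp.differentiableWithinAt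

lemma norm_kernel_le (hsum : Summable fun p => Real.exp (-ℓ p / α)) {ζ : ℂ}
    (hζ : ζ ∈ logStrip α) (k : ℕ) : ‖kernel α ℓ ζ‖ ≤ Real.exp (logSum ℓ k - k * ζ.re) := by
  have hs := summable_log_one_add_kernelVar hsum hζ
  have hfactor : ∀ p, max 0 ((ζ.re - ℓ p) / α)
      ≤ (Complex.log (1 + kernelVar α (ℓ p) ζ)).re := fun p => by
    rw [← Real.log_exp ((ζ.re - ℓ p) / α), ← norm_kernelVar]
    exact max_log_norm_le_re_log_one_add (kernelVar_re_pos (ℓ p) hζ).le (Complex.exp_ne_zero _)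
  have hpartial : (k * ζ.re - logSum ℓ k) / α
      ≤ ∑' p, (Complex.log (1 + kernelVar α (ℓ p) ζ)).re := by
    rw [← sum_range_sub_div]
    exact (Finset.sum_le_sum fun p _ => (le_max_right _ _).trans (hfactor p)).trans
      ((Complex.hasSum_re hs.hasSum).summable.sum_le_tsum _
        fun p _ => (le_max_left _ _).trans (hfactor p))
  rw [div_le_iff₀ α.2] at hpartial
  rw [kernel, Complex.norm_exp, ← Complex.ofReal_neg, Complex.re_ofReal_mul, Complex.re_tsum hs]
  exact Real.exp_le_exp.2 (by linarith)

lemma kernel_ofReal (s : ℝ) : kernel α ℓ s = realKernel α ℓ s := by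
  have hlog : ∀ p, Complex.log (1 + kernelVar α (ℓ p) s)
      = (Real.log (1 + Real.exp ((s - ℓ p) / α)) : ℝ) := fun p => by
    rw [Complex.ofReal_log (by positivity), kernelVar]
    push_cast
    rfl
  simp only [kernel, realKernel, hlog]
  push_cast
  rfl

lemma log_one_add_exp_le (x : ℝ) : Real.log (1 + Real.exp x) ≤ Real.exp x := by
  have hlog := Real.log_le_sub_one_of_pos (x := 1 + Real.exp x) (by positivity)
  rwa [add_sub_cancel_left] at hlog

lemma summable_log_one_add_exp (hsum : Summable fun p => Real.exp (-ℓ p / α)) (s : ℝ) :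
    Summable fun p => Real.log (1 + Real.exp ((s - ℓ p) / α)) := by
  refine Summable.of_nonneg_of_le (fun p => Real.log_nonneg ?_)
    (fun p => (log_one_add_exp_le _).trans_eq (exp_sub_div s (ℓ p)))
    (hsum.mul_left (Real.exp (s / α)))
  exact le_add_of_nonneg_right (Real.exp_pos _).le

lemma antitone_realKernel (hsum : Summable fun p => Real.exp (-ℓ p / α)) :
    Antitone (realKernel α ℓ) := by
  intro s t hst
  have hα := α.2
  refine Real.exp_le_exp.2 (mul_le_mul_of_nonpos_left ?_ (neg_nonpos.2 hα.le))
  exact (summable_log_one_add_exp hsum s).tsum_le_tsum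
    (fun p => Real.log_le_log (by positivity) (by gcongr)) (summable_log_one_add_exp hsum t)

end Kernel

lemma sum_range_add_succ_rpow_neg_le {x θ : ℝ} (hx : 0 < x) (hθ : 1 < θ) (n : ℕ) :
    ∑ j ∈ Finset.range n, (x + (j + 1 : ℕ)) ^ (-θ) ≤ x ^ (1 - θ) / (θ - 1) := by
  have hpos : ∀ y ∈ Set.Icc x (x + n), 0 < y := fun y hy => hx.trans_le hy.1
  have hanti : AntitoneOn (fun y : ℝ => y ^ (-θ)) (Set.Icc x (x + n)) := fun y hy z _ hyz =>
    Real.rpow_le_rpow_of_nonpos (hpos y hy) hyz (by linarith)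
  have hzero : (0 : ℝ) ∉ Set.uIcc x (x + n) := by
    rw [Set.uIcc_of_le (by simp)]
    exact fun h => (hpos 0 h).false
  refine hanti.sum_le_integral.trans ?_
  rw [integral_rpow (Or.inr ⟨by linarith, hzero⟩), ← neg_div_neg_eq, neg_sub, neg_add_eq_sub,
    neg_sub]
  have hend : 0 ≤ (x + n) ^ (1 - θ) := by positivity
  gcongr
  linarith

lemma sum_range_div_rpow_le {x θ : ℝ} (hx : 1 ≤ x) (hθ : 1 < θ) (n : ℕ) :
    ∑ j ∈ Finset.range n, (x / (x + j)) ^ θ ≤ (1 + 1 / (θ - 1)) * x := by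
  have hx₀ : 0 < x := one_pos.trans_le hx
  have hterm : ∀ j : ℕ, (x / (x + j)) ^ θ = x ^ θ * (x + j) ^ (-θ) := fun j => by
    rw [Real.div_rpow hx₀.le (by positivity), Real.rpow_neg (by positivity), div_eq_mul_inv]
  calc ∑ j ∈ Finset.range n, (x / (x + j)) ^ θ
      ≤ ∑ j ∈ Finset.range (n + 1), (x / (x + j)) ^ θ :=
        Finset.sum_le_sum_of_subset_of_nonneg (Finset.range_mono n.le_succ)
          fun j _ _ => by positivity
    _ = x ^ θ * ∑ j ∈ Finset.range n, (x + (j + 1 : ℕ)) ^ (-θ) + 1 := by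
        rw [Finset.sum_range_succ', Nat.cast_zero, add_zero, div_self hx₀.ne', Real.one_rpow,
          Finset.mul_sum]
        simp only [hterm]
    _ ≤ x ^ θ * (x ^ (1 - θ) / (θ - 1)) + x := by
        gcongr
        exact sum_range_add_succ_rpow_neg_le hx₀ hθ n
    _ = (1 + 1 / (θ - 1)) * x := by
        rw [← mul_div_assoc, ← Real.rpow_add hx₀, add_sub_cancel, Real.rpow_one]
        ring

section AlmostIncreasing

variable {α : PosReal} {ℓ : ℕ → ℝ} {β : ℝ}

lemma AlmostIncreasing.exists_exp_sub_le
    (h : AlmostIncreasing fun p => Real.exp (ℓ p) / ((p : ℝ) + 1) ^ β) :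
    ∃ a : ℝ, 0 < a ∧ ∀ k p : ℕ, k ≤ p →
      Real.exp (ℓ k - ℓ p) ≤ a * (((k : ℝ) + 1) / (p + 1)) ^ β := by
  obtain ⟨a, ha, hle⟩ := h
  refine ⟨a, ha, fun k p hkp => ?_⟩
  have hkp' := hle k p hkp
  rw [div_le_iff₀ (by positivity)] at hkp'
  rw [Real.exp_sub, div_le_iff₀ (Real.exp_pos _), Real.div_rpow (by positivity) (by positivity)]
  exact hkp'.trans_eq (by ring)

lemma exp_sub_div_le {a q l m : ℝ} (ha : 0 ≤ a) (hq : 0 ≤ q)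
    (h : Real.exp (l - m) ≤ a * q ^ β) :
    Real.exp ((l - m) / α) ≤ a ^ (α : ℝ)⁻¹ * q ^ (β / α) := by
  have hα := α.2
  rw [div_eq_mul_inv (l - m), Real.exp_mul, div_eq_mul_inv β, Real.rpow_mul hq,
    ← Real.mul_rpow ha (by positivity)]
  gcongr

lemma AlmostIncreasing.exists_tail_bound
    (h : AlmostIncreasing fun p => Real.exp (ℓ p) / ((p : ℝ) + 1) ^ β) (hαβ : α < β) :
    ∃ D : ℝ, 0 ≤ D ∧ ∀ k : ℕ, (Summable fun j => Real.exp ((ℓ k - ℓ (j + k)) / α)) ∧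
      ∑' j, Real.exp ((ℓ k - ℓ (j + k)) / α) ≤ D * (k + 1) := by
  obtain ⟨a, ha, hle⟩ := h.exists_exp_sub_le
  have hθ : 1 < β / α := (one_lt_div α.2).2 hαβ
  have : 0 < β / α - 1 := sub_pos.2 hθ
  refine ⟨a ^ (α : ℝ)⁻¹ * (1 + 1 / (β / α - 1)), by positivity, fun k => ?_⟩
  have hpartial : ∀ n, ∑ j ∈ Finset.range n, Real.exp ((ℓ k - ℓ (j + k)) / α)
      ≤ a ^ (α : ℝ)⁻¹ * (1 + 1 / (β / α - 1)) * (k + 1) := fun n => by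
    have hterm : ∀ j : ℕ, Real.exp ((ℓ k - ℓ (j + k)) / α)
        ≤ a ^ (α : ℝ)⁻¹ * (((k : ℝ) + 1) / (k + 1 + j)) ^ (β / α) := fun j => by
      refine exp_sub_div_le ha.le (by positivity) ((hle k (j + k) (k.le_add_left j)).trans_eq ?_)
      push_cast
      ring_nf
    refine (Finset.sum_le_sum fun j _ => hterm j).trans ?_
    rw [← Finset.mul_sum, mul_assoc]
    exact mul_le_mul_of_nonneg_left (sum_range_div_rpow_le (by simp) hθ n) (by positivity)
  exact ⟨summable_of_sum_range_le (fun _ => (Real.exp_pos _).le) hpartial,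
    Real.tsum_le_of_sum_range_le (fun _ => (Real.exp_pos _).le) hpartial⟩

lemma AlmostIncreasing.summable_exp_neg_div
    (h : AlmostIncreasing fun p => Real.exp (ℓ p) / ((p : ℝ) + 1) ^ β) (hαβ : α < β) :
    Summable fun p => Real.exp (-ℓ p / α) := by
  obtain ⟨D, -, hD⟩ := h.exists_tail_bound hαβ
  simpa only [exp_sub_div, summable_mul_left_iff (Real.exp_ne_zero _), add_zero] using (hD 0).1

lemma log_one_add_exp_le_of_neg_le {x c : ℝ} (h : -c ≤ x) :
    Real.log (1 + Real.exp x) ≤ Real.log (1 + Real.exp c) + x := by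
  have hfactor : 1 + Real.exp x ≤ (1 + Real.exp c) * Real.exp x := by
    rw [add_mul, one_mul, ← Real.exp_add, add_comm]
    gcongr
    exact Real.one_le_exp (by linarith)
  refine (Real.log_le_log (by positivity) hfactor).trans_eq ?_
  rw [Real.log_mul (by positivity) (Real.exp_ne_zero x), Real.log_exp]

lemma AlmostIncreasing.exists_sub_le (hβ : 0 ≤ β)
    (h : AlmostIncreasing fun p => Real.exp (ℓ p) / ((p : ℝ) + 1) ^ β) :
    ∃ c : ℝ, ∀ k p : ℕ, k ≤ p → ℓ k - ℓ p ≤ c := by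
  obtain ⟨a, ha, hle⟩ := h.exists_exp_sub_le
  refine ⟨Real.log a, fun k p hkp => ?_⟩
  rw [Real.le_log_iff_exp_le ha]
  refine (hle k p hkp).trans (mul_le_of_le_one_right ha.le ?_)
  have hkp' : (k : ℝ) ≤ p := Nat.cast_le.2 hkp
  exact Real.rpow_le_one (by positivity) (div_le_one_of_le₀ (by linarith) (by positivity)) hβ

lemma AlmostIncreasing.exists_realKernel_lower_bound
    (h : AlmostIncreasing fun p => Real.exp (ℓ p) / ((p : ℝ) + 1) ^ β) (hαβ : α < β) :
    ∃ A : ℝ, 0 ≤ A ∧ ∀ k : ℕ,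
      Real.exp (logSum ℓ k - k * ℓ k - A * (k + 1)) ≤ realKernel α ℓ (ℓ k) := by
  have hα := α.2
  obtain ⟨D, hD₀, hD⟩ := h.exists_tail_bound hαβ
  obtain ⟨c, hc⟩ := h.exists_sub_le (hα.trans hαβ).le
  have hsum := h.summable_exp_neg_div hαβ
  set L : ℝ := Real.log (1 + Real.exp (c / α))
  have hL₀ : 0 ≤ L := Real.log_nonneg (le_add_of_nonneg_right (Real.exp_pos _).le)
  refine ⟨α * (L + D), by positivity, fun k => Real.exp_le_exp.2 ?_⟩
  have hs := summable_log_one_add_exp hsum (ℓ k)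
  have hhead : ∑ p ∈ Finset.range k, Real.log (1 + Real.exp ((ℓ k - ℓ p) / α))
      ≤ k * L + (k * ℓ k - logSum ℓ k) / α := by
    have hterm : ∀ p ∈ Finset.range k, Real.log (1 + Real.exp ((ℓ k - ℓ p) / α))
        ≤ L + (ℓ k - ℓ p) / α := fun p hp => by
      refine log_one_add_exp_le_of_neg_le ?_
      rw [← neg_div]
      gcongr
      linarith [hc p k (Finset.mem_range.1 hp).le]
    refine (Finset.sum_le_sum hterm).trans_eq ?_
    rw [Finset.sum_add_distrib, sum_range_sub_div, Finset.sum_const, Finset.card_range,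
      nsmul_eq_mul]
  have htail : ∑' j, Real.log (1 + Real.exp ((ℓ k - ℓ (j + k)) / α)) ≤ D * (k + 1) :=
    (((summable_nat_add_iff k).2 hs).tsum_le_tsum (fun j => log_one_add_exp_le _)
      (hD k).1).trans (hD k).2
  rw [← hs.sum_add_tsum_nat_add k, neg_mul, le_neg]
  refine (mul_le_mul_of_nonneg_left (add_le_add hhead htail) hα.le).trans ?_
  rw [mul_add, mul_add, mul_div_cancel₀ _ hα.ne']
  nlinarith [mul_nonneg hα.le hL₀]

end AlmostIncreasing

/-! ### Moments of the kernel -/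

section HolomorphicIntegral

variable {X E : Type*} [MeasurableSpace X] {μ : Measure X} [NormedAddCommGroup E]
  [NormedSpace ℂ E] {U : Set ℂ} {F : ℂ → X → E}

lemma aestronglyMeasurable_deriv_apply (hU : IsOpen U)
    (hmeas : ∀ ζ ∈ U, AEStronglyMeasurable (F ζ) μ)
    (hol : ∀ s, DifferentiableOn ℂ (fun ζ => F ζ s) U) {ζ : ℂ} (hζ : ζ ∈ U) :
    AEStronglyMeasurable (fun s => deriv (fun η => F η s) ζ) μ := by
  obtain ⟨u, hu, huU⟩ := exists_seq_forall_of_frequently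
    (eventually_nhdsWithin_of_eventually_nhds (s := {ζ}ᶜ) (hU.mem_nhds hζ)).frequently
  refine aestronglyMeasurable_of_tendsto_ae atTop
    (f := fun n s => (u n - ζ)⁻¹ • (F (u n) s - F ζ s))
    (fun n => ((hmeas _ (huU n)).sub (hmeas ζ hζ)).const_smul _) (ae_of_all _ fun s => ?_)
  exact (hasDerivAt_iff_tendsto_slope.1
    ((hol s).differentiableAt (hU.mem_nhds hζ)).hasDerivAt).comp hu

lemma differentiableOn_integral_of_dominated_loc (hU : IsOpen U)
    (hmeas : ∀ ζ ∈ U, AEStronglyMeasurable (F ζ) μ)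
    (hol : ∀ s, DifferentiableOn ℂ (fun ζ => F ζ s) U)
    (hdom : ∀ ζ ∈ U, ∃ G : X → ℝ, Integrable G μ ∧ ∀ᶠ η in 𝓝 ζ, ∀ s, ‖F η s‖ ≤ G s) :
    DifferentiableOn ℂ (fun ζ => ∫ s, F ζ s ∂μ) U := by
  intro ζ hζ
  obtain ⟨G, hG, hFG⟩ := hdom ζ hζ
  obtain ⟨R, hR, hball⟩ := Metric.eventually_nhds_iff_ball.1 (hFG.and (hU.mem_nhds hζ))
  have hsub : ∀ η ∈ Metric.ball ζ (R / 2), Metric.closedBall η (R / 3) ⊆ Metric.ball ζ R :=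
    fun η hη => Metric.closedBall_subset_ball' (by linarith [Metric.mem_ball.1 hη])
  have hcauchy : ∀ s, ∀ η ∈ Metric.ball ζ (R / 2),
      ‖deriv (fun η => F η s) η‖ ≤ G s / (R / 3) := fun s η hη =>
    Complex.norm_deriv_le_of_forall_mem_sphere_norm_le (by positivity)
      (((hol s).mono fun w hw => (hball w (hsub η hη hw)).2).diffContOnCl_ball subset_rfl)
      fun w hw => (hball w (hsub η hη (Metric.sphere_subset_closedBall hw))).1 s
  have hmemU : ∀ η ∈ Metric.ball ζ (R / 2), η ∈ U := fun η hη =>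
    (hball η (Metric.ball_subset_ball (by linarith) hη)).2
  have hnhds : Metric.ball ζ (R / 2) ∈ 𝓝 ζ := Metric.ball_mem_nhds ζ (by positivity)
  exact (hasDerivAt_integral_of_dominated_loc_of_deriv_le hnhds
    (eventually_of_mem hnhds fun η hη => hmeas η (hmemU η hη))
    (hG.mono' (hmeas ζ hζ) (ae_of_all _ (hball ζ (Metric.mem_ball_self hR)).1))
    (aestronglyMeasurable_deriv_apply hU hmeas hol hζ) (ae_of_all _ hcauchy)
    (hG.div_const _) (ae_of_all _ fun s η hη =>
      ((hol s).differentiableAt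
        (hU.mem_nhds (hmemU η hη))).hasDerivAt)).2.differentiableAt.differentiableWithinAt

end HolomorphicIntegral

lemma eqOn_logStrip_of_eqOn_ofReal {f g : ℂ → ℂ} (hf : DifferentiableOn ℂ f (logStrip γ))
    (hg : DifferentiableOn ℂ g (logStrip γ)) (h : ∀ x : ℝ, f x = g x) :
    Set.EqOn f g (logStrip γ) := by
  have hreal : Tendsto ((↑) : ℝ → ℂ) (𝓝[≠] 0) (𝓝[≠] ((0 : ℝ) : ℂ)) :=
    Complex.continuous_ofReal.continuousAt.continuousWithinAt.tendsto_nhdsWithin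
      fun x hx => Complex.ofReal_injective.ne hx
  exact (hf.analyticOnNhd (isOpen_logStrip γ)).eqOn_of_preconnected_of_frequently_eq
    (hg.analyticOnNhd (isOpen_logStrip γ)) (convex_logStrip γ).isPreconnected
    (ofReal_mem_logStrip γ 0) (hreal.frequently (Eventually.of_forall h).frequently)

/-- The function `exp (-dist(t, [l₁, l₂]))`, which bounds the integrands of the moments. -/
noncomputable def plateau (l₁ l₂ t : ℝ) : ℝ := Real.exp (min 0 (min (t - l₁) (l₂ - t)))

section Plateau

variable {l₁ l₂ : ℝ}

lemma plateau_nonneg (l₁ l₂ t : ℝ) : 0 ≤ plateau l₁ l₂ t := (Real.exp_pos _).le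

lemma plateau_of_le (hl : l₁ ≤ l₂) {t : ℝ} (ht : t ≤ l₁) :
    plateau l₁ l₂ t = Real.exp (-l₁) * Real.exp t := by
  rw [plateau, min_eq_left (by linarith : t - l₁ ≤ l₂ - t), min_eq_right (by linarith),
    ← Real.exp_add, neg_add_eq_sub]

lemma plateau_of_mem_Icc {t : ℝ} (h₁ : l₁ ≤ t) (h₂ : t ≤ l₂) : plateau l₁ l₂ t = 1 := by
  rw [plateau, min_eq_left (le_min (sub_nonneg.2 h₁) (sub_nonneg.2 h₂)), Real.exp_zero]

lemma plateau_of_ge (hl : l₁ ≤ l₂) {t : ℝ} (ht : l₂ ≤ t) :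
    plateau l₁ l₂ t = Real.exp l₂ * Real.exp (-t) := by
  rw [plateau, min_eq_right (by linarith : l₂ - t ≤ t - l₁), min_eq_right (by linarith),
    ← Real.exp_add, sub_eq_add_neg]

lemma plateau_le_exp_dist_mul (l₁ l₂ t t' : ℝ) :
    plateau l₁ l₂ t ≤ Real.exp |t - t'| * plateau l₁ l₂ t' := by
  have hle := le_abs_self (t - t')
  have hge := neg_abs_le (t - t')
  rw [plateau, plateau, ← Real.exp_add, ← min_add_add_left, ← min_add_add_left]
  exact Real.exp_le_exp.2 (min_le_min (by linarith [abs_nonneg (t - t')])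
    (min_le_min (by linarith) (by linarith)))

lemma integrableOn_plateau_Iic (hl : l₁ ≤ l₂) : IntegrableOn (plateau l₁ l₂) (Set.Iic l₁) :=
  IntegrableOn.congr_fun ((integrableOn_exp_Iic l₁).const_mul _)
    (fun _ ht => (plateau_of_le hl ht).symm) measurableSet_Iic

lemma integrableOn_plateau_Ioc (l₁ l₂ : ℝ) : IntegrableOn (plateau l₁ l₂) (Set.Ioc l₁ l₂) :=
  (integrableOn_const (by simp) : IntegrableOn (fun _ => (1 : ℝ)) _).congr_fun
    (fun _ ht => (plateau_of_mem_Icc ht.1.le ht.2).symm) measurableSet_Ioc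

lemma integrableOn_plateau_Ioi (hl : l₁ ≤ l₂) : IntegrableOn (plateau l₁ l₂) (Set.Ioi l₂) :=
  IntegrableOn.congr_fun ((integrableOn_exp_neg_Ioi l₂).const_mul _)
    (fun _ ht => (plateau_of_ge hl (le_of_lt ht)).symm) measurableSet_Ioi

lemma integrableOn_plateau_Ioi_left (hl : l₁ ≤ l₂) :
    IntegrableOn (plateau l₁ l₂) (Set.Ioi l₁) := by
  rw [← Set.Ioc_union_Ioi_eq_Ioi hl]
  exact (integrableOn_plateau_Ioc l₁ l₂).union (integrableOn_plateau_Ioi hl)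

lemma integrable_plateau (hl : l₁ ≤ l₂) : Integrable (plateau l₁ l₂) := by
  rw [← integrableOn_univ, ← Set.Iic_union_Ioi (a := l₁)]
  exact (integrableOn_plateau_Iic hl).union (integrableOn_plateau_Ioi_left hl)

lemma integral_plateau (hl : l₁ ≤ l₂) : ∫ t, plateau l₁ l₂ t = 2 + (l₂ - l₁) := by
  have hleft : ∫ t in Set.Iic l₁, plateau l₁ l₂ t = 1 := by
    rw [setIntegral_congr_fun measurableSet_Iic fun t ht => plateau_of_le hl ht,
      integral_const_mul, integral_exp_Iic, ← Real.exp_add, neg_add_cancel, Real.exp_zero]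
  have hmiddle : ∫ t in Set.Ioc l₁ l₂, plateau l₁ l₂ t = l₂ - l₁ := by
    rw [setIntegral_congr_fun measurableSet_Ioc fun t ht => plateau_of_mem_Icc ht.1.le ht.2,
      setIntegral_const, Real.volume_real_Ioc_of_le hl, smul_eq_mul, mul_one]
  have hright : ∫ t in Set.Ioi l₂, plateau l₁ l₂ t = 1 := by
    rw [setIntegral_congr_fun measurableSet_Ioi fun t ht => plateau_of_ge hl (le_of_lt ht),
      integral_const_mul, integral_exp_neg_Ioi, ← Real.exp_add, add_neg_cancel, Real.exp_zero]
  rw [← intervalIntegral.integral_Iic_add_Ioi (integrableOn_plateau_Iic hl)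
      (integrableOn_plateau_Ioi_left hl), ← Set.Ioc_union_Ioi_eq_Ioi hl,
    setIntegral_union (Set.Ioc_disjoint_Ioi le_rfl) measurableSet_Ioi
      (integrableOn_plateau_Ioc l₁ l₂) (integrableOn_plateau_Ioi hl), hleft, hmiddle, hright]
  ring

end Plateau

/-- The transform `∫ e(u / z) ψ(u) du / u` with the kernel `e`, in the coordinates `ζ = log z` and
`s = log u`. -/
noncomputable def kernelTransform (α : PosReal) (ℓ : ℕ → ℝ) (ψ : ℝ → ℂ) (ζ : ℂ) : ℂ :=
  ∫ s : ℝ, kernel α ℓ (s - ζ) * ψ s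

/-- The moments `∫ e(u) u ^ k du / u` of the kernel `e`, in the coordinate `s = log u`. -/
noncomputable def moment (α : PosReal) (ℓ : ℕ → ℝ) (k : ℕ) : ℝ :=
  ∫ s : ℝ, realKernel α ℓ s * Real.exp s ^ k

section Transform

variable {α : PosReal} {ℓ : ℕ → ℝ}

lemma norm_kernel_mul_exp_pow_le (hsum : Summable fun p => Real.exp (-ℓ p / α)) {ζ : ℂ}
    (hζ : ζ ∈ logStrip α) (k : ℕ) :
    ‖kernel α ℓ ζ‖ * Real.exp ζ.re ^ (k + 1)
      ≤ Real.exp (logSum ℓ (k + 1)) * plateau (ℓ k) (max (ℓ k) (ℓ (k + 1))) ζ.re := by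
  have hexp : ∀ n : ℕ, ‖kernel α ℓ ζ‖ * Real.exp ζ.re ^ (k + 1)
      ≤ Real.exp (logSum ℓ n - n * ζ.re + (k + 1 : ℕ) * ζ.re) := fun n => by
    rw [Real.exp_add, Real.exp_nat_mul]
    exact mul_le_mul_of_nonneg_right (norm_kernel_le hsum hζ n) (by positivity)
  rw [plateau, ← Real.exp_add, ← min_add_add_left, ← min_add_add_left,
    Real.exp_monotone.map_min, Real.exp_monotone.map_min]
  refine le_min ((hexp (k + 1)).trans (Real.exp_le_exp.2 ?_))
    (le_min ((hexp k).trans (Real.exp_le_exp.2 ?_))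
      ((hexp (k + 2)).trans (Real.exp_le_exp.2 ?_)))
  · linarith
  · push_cast
    linarith [logSum_succ ℓ k]
  · push_cast
    linarith [logSum_succ ℓ (k + 1), le_max_right (ℓ k) (ℓ (k + 1))]

lemma ofReal_sub_mem_logStrip {ζ : ℂ} (hζ : ζ ∈ logStrip α) (s : ℝ) :
    (s : ℂ) - ζ ∈ logStrip α := by
  rw [mem_logStrip] at hζ ⊢
  rwa [Complex.sub_im, Complex.ofReal_im, zero_sub, abs_neg]

lemma continuous_kernel_sub (hsum : Summable fun p => Real.exp (-ℓ p / α)) {ζ : ℂ}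
    (hζ : ζ ∈ logStrip α) : Continuous fun s : ℝ => kernel α ℓ (s - ζ) :=
  (differentiableOn_kernel hsum).continuousOn.comp_continuous (by fun_prop)
    (ofReal_sub_mem_logStrip hζ)

section MonomialBound

variable {ψ : ℝ → ℂ} {C : ℝ} {k : ℕ}

lemma norm_kernel_sub_mul_le (hsum : Summable fun p => Real.exp (-ℓ p / α)) {ζ : ℂ}
    (hζ : ζ ∈ logStrip α) (hψ : ∀ s, ‖ψ s‖ ≤ C * Real.exp s ^ (k + 1)) (s : ℝ) :
    ‖kernel α ℓ (s - ζ) * ψ s‖ ≤ C * Real.exp (logSum ℓ (k + 1)) * Real.exp ζ.re ^ (k + 1) *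
      plateau (ℓ k) (max (ℓ k) (ℓ (k + 1))) (s - ζ.re) := by
  have hC : 0 ≤ C := nonneg_of_mul_nonneg_left ((norm_nonneg _).trans (hψ 0)) (by positivity)
  have hkernel := norm_kernel_mul_exp_pow_le hsum (ofReal_sub_mem_logStrip hζ s) k
  rw [Complex.sub_re, Complex.ofReal_re] at hkernel
  calc ‖kernel α ℓ (s - ζ) * ψ s‖
      ≤ ‖kernel α ℓ (s - ζ)‖ * (C * (Real.exp (s - ζ.re) * Real.exp ζ.re) ^ (k + 1)) := by
        rw [norm_mul, ← Real.exp_add, sub_add_cancel]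
        exact mul_le_mul_of_nonneg_left (hψ s) (norm_nonneg _)
    _ = C * Real.exp ζ.re ^ (k + 1) *
          (‖kernel α ℓ (s - ζ)‖ * Real.exp (s - ζ.re) ^ (k + 1)) := by ring
    _ ≤ C * Real.exp ζ.re ^ (k + 1) * (Real.exp (logSum ℓ (k + 1)) *
          plateau (ℓ k) (max (ℓ k) (ℓ (k + 1))) (s - ζ.re)) := by gcongr
    _ = _ := by ring

lemma integrable_kernel_sub_mul (hsum : Summable fun p => Real.exp (-ℓ p / α)) {ζ : ℂ}
    (hζ : ζ ∈ logStrip α) (hψm : AEStronglyMeasurable ψ volume)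
    (hψ : ∀ s, ‖ψ s‖ ≤ C * Real.exp s ^ (k + 1)) :
    Integrable fun s : ℝ => kernel α ℓ (s - ζ) * ψ s :=
  (((integrable_plateau (le_max_left _ _)).comp_sub_right ζ.re).const_mul _).mono'
    ((continuous_kernel_sub hsum hζ).aestronglyMeasurable.mul hψm)
    (ae_of_all _ (norm_kernel_sub_mul_le hsum hζ hψ))

lemma norm_kernelTransform_le (hsum : Summable fun p => Real.exp (-ℓ p / α)) {ζ : ℂ}
    (hζ : ζ ∈ logStrip α) (hψ : ∀ s, ‖ψ s‖ ≤ C * Real.exp s ^ (k + 1)) :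
    ‖kernelTransform α ℓ ψ ζ‖ ≤ C * Real.exp (logSum ℓ (k + 1)) * Real.exp ζ.re ^ (k + 1) *
      (2 + (max (ℓ k) (ℓ (k + 1)) - ℓ k)) := by
  rw [← integral_plateau (le_max_left _ _), ← integral_sub_right_eq_self _ ζ.re,
    ← integral_const_mul]
  exact norm_integral_le_of_norm_le
    (((integrable_plateau (le_max_left _ _)).comp_sub_right ζ.re).const_mul _)
    (ae_of_all _ (norm_kernel_sub_mul_le hsum hζ hψ))

lemma differentiableOn_kernelTransform (hsum : Summable fun p => Real.exp (-ℓ p / α))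
    (hψm : AEStronglyMeasurable ψ volume) (hψ : ∀ s, ‖ψ s‖ ≤ C * Real.exp s ^ (k + 1)) :
    DifferentiableOn ℂ (kernelTransform α ℓ ψ) (logStrip α) := by
  have hC : 0 ≤ C := nonneg_of_mul_nonneg_left ((norm_nonneg _).trans (hψ 0)) (by positivity)
  refine differentiableOn_integral_of_dominated_loc (isOpen_logStrip α)
    (fun ζ hζ => (continuous_kernel_sub hsum hζ).aestronglyMeasurable.mul hψm)
    (fun s => ((differentiableOn_kernel hsum).comp (by fun_prop)
      fun ζ hζ => ofReal_sub_mem_logStrip hζ s).mul_const _) fun ζ hζ => ?_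
  refine ⟨_, (((integrable_plateau
    (le_max_left (ℓ k) (ℓ (k + 1)))).comp_sub_right ζ.re).const_mul
    (C * Real.exp (logSum ℓ (k + 1)) * Real.exp (ζ.re + 1) ^ (k + 1) * Real.exp 1)), ?_⟩
  filter_upwards [(isOpen_logStrip α).mem_nhds hζ, Metric.ball_mem_nhds ζ one_pos] with η hη hball s
  have hre : |η.re - ζ.re| ≤ 1 := by
    rw [← Complex.sub_re]
    exact (Complex.abs_re_le_norm _).trans (mem_ball_iff_norm.1 hball).le
  have hplateau := plateau_le_exp_dist_mul (ℓ k) (max (ℓ k) (ℓ (k + 1))) (s - η.re) (s - ζ.re)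
  rw [sub_sub_sub_cancel_left, abs_sub_comm] at hplateau
  refine (norm_kernel_sub_mul_le hsum hη hψ s).trans ?_
  rw [mul_assoc _ (Real.exp 1)]
  have := plateau_nonneg (ℓ k) (max (ℓ k) (ℓ (k + 1))) (s - ζ.re)
  gcongr
  · exact plateau_nonneg _ _ _
  · linarith [(abs_le.1 hre).2]
  · exact hplateau.trans (by gcongr)

end MonomialBound

lemma norm_exp_ofReal_pow (s : ℝ) (n : ℕ) : ‖Complex.exp s ^ n‖ = Real.exp s ^ n := by
  rw [norm_pow, Complex.norm_exp, Complex.ofReal_re]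

lemma integrable_kernel_sub_mul_exp_pow (hsum : Summable fun p => Real.exp (-ℓ p / α)) {ζ : ℂ}
    (hζ : ζ ∈ logStrip α) (k : ℕ) :
    Integrable fun s : ℝ => kernel α ℓ (s - ζ) * Complex.exp s ^ (k + 1) :=
  integrable_kernel_sub_mul hsum hζ (C := 1) (Continuous.aestronglyMeasurable (by fun_prop))
    fun s => by rw [norm_exp_ofReal_pow, one_mul]

lemma kernelTransform_exp_pow_ofReal (n : ℕ) (x : ℝ) :
    kernelTransform α ℓ (fun s => Complex.exp s ^ n) x = moment α ℓ n * Complex.exp x ^ n := by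
  rw [kernelTransform, ← integral_add_right_eq_self _ x, moment, ← integral_complex_ofReal,
    ← integral_mul_const]
  refine integral_congr_ae (ae_of_all _ fun s => ?_)
  simp only [Complex.ofReal_add, add_sub_cancel_right, kernel_ofReal, Complex.exp_add, mul_pow,
    Complex.ofReal_mul, Complex.ofReal_pow, Complex.ofReal_exp, mul_assoc]

lemma kernelTransform_exp_pow (hsum : Summable fun p => Real.exp (-ℓ p / α)) {ζ : ℂ}
    (hζ : ζ ∈ logStrip α) (k : ℕ) :
    kernelTransform α ℓ (fun s => Complex.exp s ^ (k + 1)) ζ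
      = moment α ℓ (k + 1) * Complex.exp ζ ^ (k + 1) := by
  have hleft : DifferentiableOn ℂ (kernelTransform α ℓ fun s => Complex.exp s ^ (k + 1))
      (logStrip α) :=
    differentiableOn_kernelTransform hsum (C := 1) (Continuous.aestronglyMeasurable (by fun_prop))
      fun s => by rw [norm_exp_ofReal_pow, one_mul]
  have hright : Differentiable ℂ fun η => moment α ℓ (k + 1) * Complex.exp η ^ (k + 1) := by
    fun_prop
  exact eqOn_logStrip_of_eqOn_ofReal hleft hright.differentiableOn
    (kernelTransform_exp_pow_ofReal (k + 1)) hζ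

lemma realKernel_pos (s : ℝ) : 0 < realKernel α ℓ s := Real.exp_pos _

lemma integrable_realKernel_mul_exp_pow (hsum : Summable fun p => Real.exp (-ℓ p / α)) (k : ℕ) :
    Integrable fun s => realKernel α ℓ s * Real.exp s ^ (k + 1) := by
  have hre := (integrable_kernel_sub_mul_exp_pow hsum (ofReal_mem_logStrip α 0) k).norm
  simpa only [Complex.ofReal_zero, sub_zero, kernel_ofReal, norm_mul, norm_exp_ofReal_pow,
    Complex.norm_real, Real.norm_of_nonneg (realKernel_pos _).le] using hre

lemma integrableOn_exp_pow_Iic (k : ℕ) (x : ℝ) :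
    IntegrableOn (fun s => Real.exp s ^ (k + 1)) (Set.Iic x) := by
  simpa only [← Real.exp_nat_mul] using
    integrableOn_exp_mul_Iic (a := (k + 1 : ℕ)) (by positivity) x

lemma integral_exp_pow_Iic (k : ℕ) (x : ℝ) :
    ∫ s in Set.Iic x, Real.exp s ^ (k + 1) = Real.exp x ^ (k + 1) / (k + 1) := by
  simp only [← Real.exp_nat_mul]
  rw [integral_exp_mul_Iic (by positivity), Nat.cast_succ]

lemma realKernel_mul_exp_pow_le_moment (hsum : Summable fun p => Real.exp (-ℓ p / α)) (k : ℕ)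
    (x : ℝ) : realKernel α ℓ x * (Real.exp x ^ (k + 1) / (k + 1)) ≤ moment α ℓ (k + 1) := by
  have hint := integrable_realKernel_mul_exp_pow hsum k
  calc realKernel α ℓ x * (Real.exp x ^ (k + 1) / (k + 1))
      = ∫ s in Set.Iic x, realKernel α ℓ x * Real.exp s ^ (k + 1) := by
        rw [integral_const_mul, integral_exp_pow_Iic]
    _ ≤ ∫ s in Set.Iic x, realKernel α ℓ s * Real.exp s ^ (k + 1) :=
        setIntegral_mono_on ((integrableOn_exp_pow_Iic k x).const_mul _) hint.integrableOn
          measurableSet_Iic fun s hs =>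
            mul_le_mul_of_nonneg_right (antitone_realKernel hsum hs) (by positivity)
    _ ≤ moment α ℓ (k + 1) := setIntegral_le_integral hint
        (ae_of_all _ fun s => mul_nonneg (realKernel_pos s).le (by positivity))

lemma moment_succ_pos (hsum : Summable fun p => Real.exp (-ℓ p / α)) (k : ℕ) :
    0 < moment α ℓ (k + 1) :=
  (mul_pos (realKernel_pos 0) (by positivity)).trans_le (realKernel_mul_exp_pow_le_moment hsum k 0)

end Transform

lemma AlmostIncreasing.exists_moment_lower_bound {α : PosReal} {β : ℝ} {ℓ : ℕ → ℝ}
    (h : AlmostIncreasing fun p => Real.exp (ℓ p) / ((p : ℝ) + 1) ^ β) (hαβ : α < β) :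
    ∃ B : ℝ, 1 ≤ B ∧ ∀ k, Real.exp (logSum ℓ (k + 1)) ≤ B ^ (k + 2) * moment α ℓ (k + 1) := by
  obtain ⟨A, hA, hkernel⟩ := h.exists_realKernel_lower_bound hαβ
  have hsum := h.summable_exp_neg_div hαβ
  refine ⟨2 * Real.exp A, by linarith [Real.one_le_exp hA], fun k => ?_⟩
  have htwo : (k : ℝ) + 1 ≤ 2 ^ (k + 2) := by
    exact_mod_cast (Nat.lt_succ_self (k + 1)).le.trans (Nat.lt_two_pow_self (n := k + 2)).le
  have hmoment := realKernel_mul_exp_pow_le_moment (α := α) hsum k (ℓ (k + 1))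
  rw [← mul_div_assoc, div_le_iff₀ (by positivity)] at hmoment
  calc Real.exp (logSum ℓ (k + 1))
      = Real.exp A ^ (k + 2) * (Real.exp (logSum ℓ (k + 1) - (k + 1 : ℕ) * ℓ (k + 1)
          - A * ((k + 1 : ℕ) + 1)) * Real.exp (ℓ (k + 1)) ^ (k + 1)) := by
        simp only [← Real.exp_nat_mul, ← Real.exp_add]
        push_cast
        ring_nf
    _ ≤ Real.exp A ^ (k + 2) * (moment α ℓ (k + 1) * (k + 1)) := by
        refine mul_le_mul_of_nonneg_left ?_ (by positivity)
        exact (mul_le_mul_of_nonneg_right (hkernel (k + 1)) (by positivity)).trans hmoment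
    _ ≤ Real.exp A ^ (k + 2) * (moment α ℓ (k + 1) * 2 ^ (k + 2)) := by
        have := (moment_succ_pos (α := α) hsum k).le
        gcongr
    _ = (2 * Real.exp A) ^ (k + 2) * moment α ℓ (k + 1) := by ring

/-! ### Truncated Laplace transforms -/

/-- Geometric decay of `b`, at a rate for which the series `∑ b_k u ^ (k + 1)` converges like
`∑ 2 ^ (-k)` on `(0, e ^ ρ]`. -/
def GeometricDecay (ρ K : ℝ) (b : ℕ → ℂ) : Prop :=
  ∀ k, ‖b k‖ ≤ K * (Real.exp (-ρ) / 2) ^ (k + 1)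

/-- The sum `∑ b_k u ^ (k + 1)` at `u = e ^ s`, cut off at `s = ρ`. -/
noncomputable def cutoffSum (ρ : ℝ) (b : ℕ → ℂ) : ℝ → ℂ :=
  (Set.Iic ρ).indicator fun s => ∑' k, b k * Complex.exp s ^ (k + 1)

lemma hasSum_half_pow_succ : HasSum (fun k : ℕ => (1 / 2 : ℝ) ^ (k + 1)) 1 := by
  simpa only [pow_succ, mul_one_div_cancel (two_ne_zero' ℝ)] using
    hasSum_geometric_two.mul_right (1 / 2 : ℝ)

section CutoffSum

variable {ρ K : ℝ} {b : ℕ → ℂ}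

lemma cutoffSum_of_le {s : ℝ} (hs : s ≤ ρ) :
    cutoffSum ρ b s = ∑' k, b k * Complex.exp s ^ (k + 1) :=
  Set.indicator_of_mem (Set.mem_Iic.2 hs) _

lemma cutoffSum_of_lt {s : ℝ} (hs : ρ < s) : cutoffSum ρ b s = 0 :=
  Set.indicator_of_notMem (Set.notMem_Iic.2 hs) _

namespace GeometricDecay

lemma nonneg (hb : GeometricDecay ρ K b) : 0 ≤ K :=
  nonneg_of_mul_nonneg_left ((norm_nonneg _).trans (hb 0)) (by positivity)

lemma norm_mul_exp_pow_le (hb : GeometricDecay ρ K b) (k : ℕ) (s : ℝ) :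
    ‖b k * Complex.exp s ^ (k + 1)‖ ≤ K * Real.exp (s - ρ) ^ (k + 1) * (1 / 2) ^ (k + 1) := by
  rw [norm_mul, norm_exp_ofReal_pow]
  refine (mul_le_mul_of_nonneg_right (hb k) (by positivity)).trans_eq ?_
  rw [sub_eq_add_neg, Real.exp_add]
  ring

lemma norm_mul_exp_pow_le_half_pow (hb : GeometricDecay ρ K b) (k : ℕ) {s : ℝ} (hs : s ≤ ρ) :
    ‖b k * Complex.exp s ^ (k + 1)‖ ≤ K * (1 / 2) ^ (k + 1) := by
  refine (hb.norm_mul_exp_pow_le k s).trans ?_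
  gcongr
  exact mul_le_of_le_one_right hb.nonneg
    (pow_le_one₀ (Real.exp_pos _).le (Real.exp_le_one_iff.2 (sub_nonpos.2 hs)))

lemma summable (hb : GeometricDecay ρ K b) {s : ℝ} (hs : s ≤ ρ) :
    Summable fun k => b k * Complex.exp s ^ (k + 1) :=
  Summable.of_norm_bounded (hasSum_half_pow_succ.summable.mul_left K)
    fun k => hb.norm_mul_exp_pow_le_half_pow k hs

lemma aestronglyMeasurable_cutoffSum (hb : GeometricDecay ρ K b) :
    AEStronglyMeasurable (cutoffSum ρ b) volume := by
  rw [cutoffSum, aestronglyMeasurable_indicator_iff measurableSet_Iic]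
  refine ContinuousOn.aestronglyMeasurable ?_ measurableSet_Iic
  exact continuousOn_tsum (fun k => by fun_prop) (hasSum_half_pow_succ.summable.mul_left K)
    fun k s hs => hb.norm_mul_exp_pow_le_half_pow k hs

lemma norm_tsum_sub_le (hb : GeometricDecay ρ K b) (p : ℕ) {s : ℝ} (hs : s ≤ ρ) :
    ‖∑' k, b k * Complex.exp s ^ (k + 1) - ∑ k ∈ Finset.range p, b k * Complex.exp s ^ (k + 1)‖
      ≤ K * Real.exp (s - ρ) ^ (p + 1) := by
  have hK := hb.nonneg
  have hexp : Real.exp (s - ρ) ≤ 1 := Real.exp_le_one_iff.2 (sub_nonpos.2 hs)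
  have hsum := hasSum_half_pow_succ.mul_left (K * Real.exp (s - ρ) ^ (p + 1))
  rw [mul_one] at hsum
  rw [← (hb.summable hs).sum_add_tsum_nat_add p, add_sub_cancel_left]
  refine tsum_of_norm_bounded hsum fun k => (hb.norm_mul_exp_pow_le (k + p) s).trans ?_
  gcongr ?_ * ?_ * ?_
  · exact pow_le_pow_of_le_one (Real.exp_pos _).le hexp (by omega)
  · exact pow_le_pow_of_le_one (by norm_num) (by norm_num) (by omega)

lemma norm_partialSum_le (hb : GeometricDecay ρ K b) (p : ℕ) {s : ℝ} (hs : ρ ≤ s) :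
    ‖∑ k ∈ Finset.range p, b k * Complex.exp s ^ (k + 1)‖ ≤ K * Real.exp (s - ρ) ^ (p + 1) := by
  have hK := hb.nonneg
  have hexp : 1 ≤ Real.exp (s - ρ) := Real.one_le_exp (sub_nonneg.2 hs)
  calc ‖∑ k ∈ Finset.range p, b k * Complex.exp s ^ (k + 1)‖
      ≤ ∑ k ∈ Finset.range p, K * Real.exp (s - ρ) ^ (p + 1) * (1 / 2) ^ (k + 1) := by
        refine norm_sum_le_of_le _ fun k hk => (hb.norm_mul_exp_pow_le k s).trans ?_
        gcongr
        exact (Finset.mem_range.1 hk).le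
    _ ≤ K * Real.exp (s - ρ) ^ (p + 1) * 1 := by
        rw [← Finset.mul_sum]
        gcongr
        exact sum_le_hasSum _ (fun k _ => by positivity) hasSum_half_pow_succ
    _ = K * Real.exp (s - ρ) ^ (p + 1) := mul_one _

lemma norm_cutoffSum_sub_le (hb : GeometricDecay ρ K b) (p : ℕ) (s : ℝ) :
    ‖cutoffSum ρ b s - ∑ k ∈ Finset.range p, b k * Complex.exp s ^ (k + 1)‖
      ≤ K * Real.exp (-ρ) ^ (p + 1) * Real.exp s ^ (p + 1) := by
  rw [mul_assoc, ← mul_pow, ← Real.exp_add, neg_add_eq_sub]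
  rcases le_or_gt s ρ with hs | hs
  · rw [cutoffSum_of_le hs]
    exact hb.norm_tsum_sub_le p hs
  · rw [cutoffSum_of_lt hs, zero_sub, norm_neg]
    exact hb.norm_partialSum_le p hs.le

lemma norm_cutoffSum_le (hb : GeometricDecay ρ K b) (s : ℝ) :
    ‖cutoffSum ρ b s‖ ≤ K * Real.exp (-ρ) * Real.exp s ^ (0 + 1) := by
  simpa only [Finset.range_zero, Finset.sum_empty, sub_zero, zero_add, pow_one] using
    hb.norm_cutoffSum_sub_le 0 s

lemma cutoffSum_add (hb : GeometricDecay ρ K b) {K' : ℝ} {b' : ℕ → ℂ}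
    (hb' : GeometricDecay ρ K' b') : cutoffSum ρ (b + b') = cutoffSum ρ b + cutoffSum ρ b' := by
  funext s
  rcases le_or_gt s ρ with hs | hs
  · simp only [Pi.add_apply, cutoffSum_of_le hs, add_mul]
    exact (hb.summable hs).tsum_add (hb'.summable hs)
  · simp only [Pi.add_apply, cutoffSum_of_lt hs, add_zero]

end GeometricDecay

lemma cutoffSum_smul (c : ℂ) (b : ℕ → ℂ) : cutoffSum ρ (c • b) = c • cutoffSum ρ b := by
  funext s
  rcases le_or_gt s ρ with hs | hs
  · simp only [Pi.smul_apply, cutoffSum_of_le hs, smul_eq_mul, mul_assoc]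
    exact tsum_mul_left
  · simp only [Pi.smul_apply, cutoffSum_of_lt hs, smul_zero]

end CutoffSum

section TransformCutoffSum

variable {α : PosReal} {ℓ : ℕ → ℝ} {ρ K : ℝ} {b : ℕ → ℂ} {ζ : ℂ}

lemma norm_kernel_le_one (hsum : Summable fun p => Real.exp (-ℓ p / α)) (hζ : ζ ∈ logStrip α) :
    ‖kernel α ℓ ζ‖ ≤ 1 := by
  simpa only [logSum, Finset.range_zero, Finset.sum_empty, Nat.cast_zero, zero_mul, sub_zero,
    Real.exp_zero] using norm_kernel_le hsum hζ 0

lemma kernelTransform_smul (c : ℂ) (ψ : ℝ → ℂ) (ζ : ℂ) :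
    kernelTransform α ℓ (c • ψ) ζ = c * kernelTransform α ℓ ψ ζ := by
  rw [kernelTransform, kernelTransform, ← integral_const_mul]
  simp only [Pi.smul_apply, smul_eq_mul, mul_left_comm]

namespace GeometricDecay

lemma integrable_kernel_sub_mul_cutoffSum (hb : GeometricDecay ρ K b)
    (hsum : Summable fun p => Real.exp (-ℓ p / α)) (hζ : ζ ∈ logStrip α) :
    Integrable fun s : ℝ => kernel α ℓ (s - ζ) * cutoffSum ρ b s :=
  integrable_kernel_sub_mul hsum hζ hb.aestronglyMeasurable_cutoffSum hb.norm_cutoffSum_le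

lemma norm_kernelTransform_cutoffSum_le (hb : GeometricDecay ρ K b)
    (hsum : Summable fun p => Real.exp (-ℓ p / α)) (hζ : ζ ∈ logStrip α) :
    ‖kernelTransform α ℓ (cutoffSum ρ b) ζ‖ ≤ K := by
  have hbound : ∀ s : ℝ, ‖kernel α ℓ (s - ζ) * cutoffSum ρ b s‖
      ≤ (Set.Iic ρ).indicator (fun s => K * Real.exp (-ρ) * Real.exp s) s := fun s => by
    rcases le_or_gt s ρ with hs | hs
    · rw [Set.indicator_of_mem (Set.mem_Iic.2 hs), norm_mul, ← pow_one (Real.exp s)]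
      exact (mul_le_of_le_one_left (norm_nonneg _)
        (norm_kernel_le_one hsum (ofReal_sub_mem_logStrip hζ s))).trans (hb.norm_cutoffSum_le s)
    · rw [Set.indicator_of_notMem (Set.notMem_Iic.2 hs), cutoffSum_of_lt hs, mul_zero, norm_zero]
  have hint : IntegrableOn (fun s => K * Real.exp (-ρ) * Real.exp s) (Set.Iic ρ) :=
    (integrableOn_exp_Iic ρ).const_mul _
  refine (norm_integral_le_of_norm_le (hint.integrable_indicator measurableSet_Iic)
    (ae_of_all _ hbound)).trans_eq ?_
  rw [integral_indicator measurableSet_Iic, integral_const_mul, integral_exp_Iic, mul_assoc,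
    ← Real.exp_add, neg_add_cancel, Real.exp_zero, mul_one]

lemma kernelTransform_cutoffSum_add (hb : GeometricDecay ρ K b) {K' : ℝ} {b' : ℕ → ℂ}
    (hb' : GeometricDecay ρ K' b') (hsum : Summable fun p => Real.exp (-ℓ p / α))
    (hζ : ζ ∈ logStrip α) :
    kernelTransform α ℓ (cutoffSum ρ (b + b')) ζ
      = kernelTransform α ℓ (cutoffSum ρ b) ζ + kernelTransform α ℓ (cutoffSum ρ b') ζ := by
  rw [hb.cutoffSum_add hb', kernelTransform, kernelTransform, kernelTransform, ← integral_add
    (hb.integrable_kernel_sub_mul_cutoffSum hsum hζ)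
    (hb'.integrable_kernel_sub_mul_cutoffSum hsum hζ)]
  simp only [Pi.add_apply, mul_add]

lemma kernelTransform_cutoffSum_sub (hb : GeometricDecay ρ K b)
    (hsum : Summable fun p => Real.exp (-ℓ p / α)) (hζ : ζ ∈ logStrip α) (p : ℕ) :
    kernelTransform α ℓ (cutoffSum ρ b) ζ
        - ∑ k ∈ Finset.range p, b k * (moment α ℓ (k + 1) * Complex.exp ζ ^ (k + 1))
      = kernelTransform α ℓ
        (fun s => cutoffSum ρ b s - ∑ k ∈ Finset.range p, b k * Complex.exp s ^ (k + 1)) ζ := by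
  have hmonomial := fun k => (integrable_kernel_sub_mul_exp_pow hsum hζ k).const_mul (b k)
  simp only [← kernelTransform_exp_pow hsum hζ, kernelTransform, mul_sub, Finset.mul_sum,
    mul_left_comm _ (b _), ← integral_const_mul]
  rw [integral_sub (hb.integrable_kernel_sub_mul_cutoffSum hsum hζ)
      (integrable_finsetSum _ fun k _ => hmonomial k),
    integral_finsetSum _ fun k _ => hmonomial k]

lemma norm_kernelTransform_cutoffSum_sub_le (hb : GeometricDecay ρ K b)
    (hsum : Summable fun p => Real.exp (-ℓ p / α)) (hζ : ζ ∈ logStrip α) (p : ℕ) :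
    ‖kernelTransform α ℓ (cutoffSum ρ b) ζ
        - ∑ k ∈ Finset.range p, b k * (moment α ℓ (k + 1) * Complex.exp ζ ^ (k + 1))‖
      ≤ K * Real.exp (-ρ) ^ (p + 1) * Real.exp (logSum ℓ (p + 1)) * Real.exp ζ.re ^ (p + 1) *
        (2 + (max (ℓ p) (ℓ (p + 1)) - ℓ p)) := by
  rw [hb.kernelTransform_cutoffSum_sub hsum hζ]
  exact norm_kernelTransform_le hsum hζ (hb.norm_cutoffSum_sub_le p)

end GeometricDecay

end TransformCutoffSum

/-! ### Extension operators -/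

namespace PosSeq

/-- The logarithms `log m_p` of the quotients. -/
noncomputable def logQuot (M : PosSeq) (p : ℕ) : ℝ := Real.log (M.quot p)

lemma quot_pos (M : PosSeq) (p : ℕ) : 0 < M.quot p := div_pos (M.pos' _) (M.pos' _)

lemma exp_logQuot (M : PosSeq) (p : ℕ) : Real.exp (M.logQuot p) = M.quot p :=
  Real.exp_log (M.quot_pos p)

lemma exp_logSum_logQuot (M : PosSeq) (k : ℕ) : Real.exp (logSum M.logQuot k) = M k := by
  induction k with
  | zero => rw [logSum, Finset.sum_range_zero, Real.exp_zero, M.zero']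
  | succ k ih =>
    rw [logSum_succ, Real.exp_add, ih, exp_logQuot, quot, mul_div_cancel₀ _ (M.pos' k).ne']

lemma ShiftedMoments.exists_max_logQuot_sub_le {M : PosSeq} (h : M.ShiftedMoments) :
    ∃ C₀ H : ℝ, 0 < C₀ ∧ 1 < H ∧
      ∀ p, max (M.logQuot p) (M.logQuot (p + 1)) - M.logQuot p ≤ C₀ * H ^ (p + 1) := by
  obtain ⟨C₀, H, hC₀, hH, hle⟩ := h
  refine ⟨C₀, H, hC₀, hH, fun p => ?_⟩
  have hp := hle p
  rw [Real.log_div (M.quot_pos _).ne' (M.quot_pos _).ne'] at hp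
  rw [← max_sub_sub_right, sub_self]
  exact max_le (by positivity) hp

end PosSeq

lemma ofReal_lt_gammaIndex_iff {M : PosSeq} {x : ℝ} :
    ENNReal.ofReal x < gammaIndex M ↔
      ∃ β, 0 < β ∧ x < β ∧ AlmostIncreasing fun p => M.quot p / ((p : ℝ) + 1) ^ β := by
  rw [gammaIndex, lt_sSup_iff, Set.exists_mem_image]
  constructor
  · rintro ⟨β, ⟨hβ, hinc⟩, hlt⟩
    exact ⟨β, hβ, (ENNReal.ofReal_lt_ofReal_iff hβ).1 hlt, hinc⟩
  · rintro ⟨β, hβ, hlt, hinc⟩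
    exact ⟨β, ⟨hβ, hinc⟩, (ENNReal.ofReal_lt_ofReal_iff hβ).2 hlt⟩

lemma Formal.norm_coeff_le {M : PosSeq} {h : PosReal} (a : Formal M h) (p : ℕ) :
    ‖PowerSeries.coeff p a.val‖ ≤ ‖a‖ * ((h : ℝ) ^ p * M p) := by
  have hpos : ∀ p : ℕ, 0 < (h : ℝ) ^ p * M p := fun p => mul_pos (pow_pos h.2 p) (M.pos' p)
  obtain ⟨C, hC⟩ := a.2
  rw [← div_le_iff₀ (hpos p)]
  exact le_ciSup (f := fun p : ℕ => ‖PowerSeries.coeff p a.val‖ / ((h : ℝ) ^ p * M p))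
    ⟨C, Set.forall_mem_range.2 fun q => (div_le_iff₀ (hpos q)).2 (hC q)⟩ p

section RemainderBound

variable {M : PosSeq} {h k : PosReal} {C : ℝ} {a : PowerSeries ℂ}

lemma HasUniformExpansion.of_norm_remainder_le {f : Sector γ → ℂ}
    (hC : ∀ p z, ‖remainder f a p z‖ ≤ C * ((h : ℝ) ^ p * M p * z.1.abs ^ p)) :
    HasUniformExpansion M h f a :=
  ⟨max 1 C, lt_max_of_lt_left one_pos, fun p z => (hC p z).trans
    (mul_le_mul_of_nonneg_right (le_max_right 1 C) (weight_pos M h p z).le)⟩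

lemma Uniform.norm_le_of_norm_remainder_le (f : Uniform M h γ)
    (hC : ∀ p z, ‖remainder f.val a p z‖ ≤ C * ((h : ℝ) ^ p * M p * z.1.abs ^ p)) : ‖f‖ ≤ C := by
  have : Nonempty (Sector γ × ℕ) := ⟨(Sector.ofPos γ 1, 0)⟩
  refine ciSup_le fun x => ?_
  rw [div_le_iff₀ (weight_pos M h x.2 x.1),
    (HasUniformExpansion.of_norm_remainder_le hC).borel_eq]
  exact hC x.2 x.1

lemma exists_isExtensionOperator_of_norm_remainder_le (T : Formal M h →ₗ[ℂ] Sector γ → ℂ)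
    (hol : ∀ a, Holomorphic (T a))
    (hT : ∀ a p z, ‖remainder (T a) a.val p z‖ ≤ C * ‖a‖ * ((k : ℝ) ^ p * M p * z.1.abs ^ p)) :
    ∃ T' : Formal M h →L[ℂ] Uniform M k γ, IsExtensionOperator T' := by
  have hexp := fun a => HasUniformExpansion.of_norm_remainder_le (hT a)
  let T' : Formal M h →ₗ[ℂ] Uniform M k γ :=
    T.codRestrict (uniformSubmodule M k γ) fun a => ⟨hol a, a.val, hexp a⟩
  exact ⟨T'.mkContinuous C fun a => (T' a).norm_le_of_norm_remainder_le (hT a),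
    fun a => (hexp a).borel_eq⟩

end RemainderBound

/-- The formal Borel transform of `∑ a_k z ^ k`, without its constant term, with respect to the
moments of the kernel; its `k`-th value belongs to the monomial of degree `k + 1`. -/
noncomputable def formalBorel (α : PosReal) (ℓ : ℕ → ℝ) (a : PowerSeries ℂ) (k : ℕ) : ℂ :=
  PowerSeries.coeff (k + 1) a / moment α ℓ (k + 1)

/-- The Laplace transform, truncated at `u = e ^ ρ`, of the formal Borel transform. -/
noncomputable def extension (α : PosReal) (ℓ : ℕ → ℝ) (ρ : ℝ) (γ : PosReal) (a : PowerSeries ℂ) :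
    Sector γ → ℂ := fun z =>
  PowerSeries.coeff 0 a + kernelTransform α ℓ (cutoffSum ρ (formalBorel α ℓ a)) z.1.log

section Extension

variable {α : PosReal} {ℓ : ℕ → ℝ} {ρ K : ℝ} {a : PowerSeries ℂ}

lemma formalBorel_add (a a' : PowerSeries ℂ) :
    formalBorel α ℓ (a + a') = formalBorel α ℓ a + formalBorel α ℓ a' := by
  funext k
  rw [Pi.add_apply, formalBorel, map_add, add_div, formalBorel, formalBorel]

lemma formalBorel_smul (c : ℂ) (a : PowerSeries ℂ) :
    formalBorel α ℓ (c • a) = c • formalBorel α ℓ a := by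
  funext k
  rw [Pi.smul_apply, formalBorel, map_smul, smul_div_assoc, formalBorel]

lemma formalBorel_mul_moment (hsum : Summable fun p => Real.exp (-ℓ p / α)) (k : ℕ) :
    formalBorel α ℓ a k * moment α ℓ (k + 1) = PowerSeries.coeff (k + 1) a :=
  div_mul_cancel₀ _ (Complex.ofReal_ne_zero.2 (moment_succ_pos hsum k).ne')

lemma extension_smul (c : ℂ) (a : PowerSeries ℂ) :
    extension α ℓ ρ γ (c • a) = c • extension α ℓ ρ γ a := by
  funext z
  simp only [extension, formalBorel_smul, cutoffSum_smul, kernelTransform_smul, map_smul,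
    Pi.smul_apply, smul_eq_mul, mul_add]

lemma extension_add (hb : GeometricDecay ρ K (formalBorel α ℓ a)) {K' : ℝ} {a' : PowerSeries ℂ}
    (hb' : GeometricDecay ρ K' (formalBorel α ℓ a'))
    (hsum : Summable fun p => Real.exp (-ℓ p / α)) (hγ : γ ≤ α) :
    extension α ℓ ρ γ (a + a') = extension α ℓ ρ γ a + extension α ℓ ρ γ a' := by
  funext z
  rw [Pi.add_apply, extension, extension, extension, formalBorel_add, map_add,
    hb.kernelTransform_cutoffSum_add hb' hsum (logStrip_mono hγ z.2), add_add_add_comm]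

lemma holomorphic_extension (hb : GeometricDecay ρ K (formalBorel α ℓ a))
    (hsum : Summable fun p => Real.exp (-ℓ p / α)) (hγ : γ ≤ α) :
    Holomorphic (extension α ℓ ρ γ a) := by
  have hdiff := differentiableOn_kernelTransform hsum hb.aestronglyMeasurable_cutoffSum
    hb.norm_cutoffSum_le
  exact ((hdiff.const_add _).mono (logStrip_mono hγ)).congr fun ζ hζ =>
    inLog_apply (extension α ℓ ρ γ a) ⟨⟨ζ⟩, hζ⟩

lemma remainder_extension_zero (z : Sector γ) :
    remainder (extension α ℓ ρ γ a) a 0 z = extension α ℓ ρ γ a z := by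
  rw [remainder, Finset.sum_range_zero, sub_zero]

lemma remainder_extension_succ (hsum : Summable fun p => Real.exp (-ℓ p / α)) (p : ℕ)
    (z : Sector γ) :
    remainder (extension α ℓ ρ γ a) a (p + 1) z
      = kernelTransform α ℓ (cutoffSum ρ (formalBorel α ℓ a)) z.1.log
        - ∑ k ∈ Finset.range p,
          formalBorel α ℓ a k * (moment α ℓ (k + 1) * Complex.exp z.1.log ^ (k + 1)) := by
  simp only [← mul_assoc, formalBorel_mul_moment hsum]
  rw [remainder, Finset.sum_range_succ', extension, pow_zero, mul_one, add_comm (∑ k ∈ _, _),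
    add_sub_add_left_eq_sub, LogSurface.proj]

end Extension

section WeightSequence

variable {α : PosReal} {M : PosSeq} {h : PosReal} {B ρ : ℝ}

lemma geometricDecay_formalBorel (hsum : Summable fun p => Real.exp (-M.logQuot p / α))
    (hM : ∀ k, M (k + 1) ≤ B ^ (k + 2) * moment α M.logQuot (k + 1))
    (hρ : Real.exp (-ρ) = 2 * B * h) (a : Formal M h) :
    GeometricDecay ρ (B * ‖a‖) (formalBorel α M.logQuot a.val) := fun k => by
  have hh := h.2
  have hpos := moment_succ_pos hsum k
  rw [formalBorel, norm_div, Complex.norm_real, Real.norm_of_nonneg hpos.le, div_le_iff₀ hpos, hρ]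
  calc ‖PowerSeries.coeff (k + 1) a.val‖
      ≤ ‖a‖ * ((h : ℝ) ^ (k + 1) * M (k + 1)) := a.norm_coeff_le (k + 1)
    _ ≤ ‖a‖ * ((h : ℝ) ^ (k + 1) * (B ^ (k + 2) * moment α M.logQuot (k + 1))) := by
        gcongr
        exact hM k
    _ = B * ‖a‖ * (2 * B * h / 2) ^ (k + 1) * moment α M.logQuot (k + 1) := by ring

lemma norm_extension_le (hsum : Summable fun p => Real.exp (-M.logQuot p / α)) (hγ : γ ≤ α)
    {a : Formal M h} (hb : GeometricDecay ρ (B * ‖a‖) (formalBorel α M.logQuot a.val))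
    (z : Sector γ) : ‖extension α M.logQuot ρ γ a.val z‖ ≤ (1 + B) * ‖a‖ := by
  have hcoeff := a.norm_coeff_le 0
  rw [pow_zero, M.zero', one_mul, mul_one] at hcoeff
  rw [add_mul, one_mul]
  exact (norm_add_le _ _).trans (add_le_add hcoeff
    (hb.norm_kernelTransform_cutoffSum_le hsum (logStrip_mono hγ z.2)))

lemma norm_remainder_extension_le (hsum : Summable fun p => Real.exp (-M.logQuot p / α))
    (hγ : γ ≤ α) (hB : 0 ≤ B) (hρ : Real.exp (-ρ) = 2 * B * h) {C₀ H : ℝ} (hC₀ : 0 ≤ C₀)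
    (hH : 1 ≤ H)
    (hsm : ∀ p, max (M.logQuot p) (M.logQuot (p + 1)) - M.logQuot p ≤ C₀ * H ^ (p + 1))
    {a : Formal M h} (hb : GeometricDecay ρ (B * ‖a‖) (formalBorel α M.logQuot a.val))
    (p : ℕ) (z : Sector γ) :
    ‖remainder (extension α M.logQuot ρ γ a.val) a.val p z‖
      ≤ (1 + B * (2 + C₀)) * ‖a‖ * ((2 * B * H * h) ^ p * M p * z.1.abs ^ p) := by
  have hh := h.2
  rcases p with _ | p
  · rw [remainder_extension_zero, pow_zero, pow_zero, M.zero', mul_one, mul_one, mul_one]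
    refine (norm_extension_le hsum hγ hb z).trans ?_
    gcongr
    exact le_mul_of_one_le_right hB (by linarith)
  have hM := M.pos' (p + 1)
  have habs := z.1.abs_pos
  have hlog : 2 + (max (M.logQuot p) (M.logQuot (p + 1)) - M.logQuot p)
      ≤ (2 + C₀) * H ^ (p + 1) := by
    linarith [hsm p, one_le_pow₀ hH (n := p + 1)]
  rw [remainder_extension_succ hsum]
  calc ‖kernelTransform α M.logQuot (cutoffSum ρ (formalBorel α M.logQuot a.val)) z.1.log
        - ∑ k ∈ Finset.range p, formalBorel α M.logQuot a.val k *
          (moment α M.logQuot (k + 1) * Complex.exp z.1.log ^ (k + 1))‖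
      ≤ B * ‖a‖ * (2 * B * h) ^ (p + 1) * M (p + 1) * z.1.abs ^ (p + 1) *
          (2 + (max (M.logQuot p) (M.logQuot (p + 1)) - M.logQuot p)) := by
        rw [← hρ, ← M.exp_logSum_logQuot]
        exact hb.norm_kernelTransform_cutoffSum_sub_le hsum (logStrip_mono hγ z.2) p
    _ ≤ B * ‖a‖ * (2 * B * h) ^ (p + 1) * M (p + 1) * z.1.abs ^ (p + 1) *
          ((2 + C₀) * H ^ (p + 1)) := by gcongr
    _ = B * (2 + C₀) * ‖a‖ * ((2 * B * H * h) ^ (p + 1) * M (p + 1) * z.1.abs ^ (p + 1)) := by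
        ring
    _ ≤ (1 + B * (2 + C₀)) * ‖a‖ *
          ((2 * B * H * h) ^ (p + 1) * M (p + 1) * z.1.abs ^ (p + 1)) := by
        gcongr
        exact le_add_of_nonneg_left zero_le_one

end WeightSequence

theorem hasLocalExtensionOperators_of_lt_gammaIndex {M : PosSeq} (hsm : M.ShiftedMoments)
    (hγ : ENNReal.ofReal γ < gammaIndex M) : HasLocalExtensionOperators M γ := by
  obtain ⟨β, -, hγβ, hinc⟩ := ofReal_lt_gammaIndex_iff.1 hγ
  obtain ⟨α, hγα, hαβ⟩ := exists_between hγβ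
  lift α to PosReal using γ.2.trans hγα
  obtain ⟨C₀, H, hC₀, hH, hlog⟩ := hsm.exists_max_logQuot_sub_le
  simp only [← M.exp_logQuot] at hinc
  have hsum := hinc.summable_exp_neg_div hαβ
  obtain ⟨B, hB, hmoment⟩ := hinc.exists_moment_lower_bound hαβ
  simp only [M.exp_logSum_logQuot] at hmoment
  refine ⟨⟨2 * B * H, by positivity⟩, fun h => ?_⟩
  have hh := h.2
  obtain ⟨ρ, hρ⟩ : ∃ ρ, Real.exp (-ρ) = 2 * B * h :=
    ⟨-Real.log (2 * B * h), by rw [neg_neg, Real.exp_log (by positivity)]⟩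
  have hb := geometricDecay_formalBorel hsum hmoment hρ
  let T : Formal M h →ₗ[ℂ] Sector γ → ℂ :=
    { toFun := fun a => extension α M.logQuot ρ γ a.val
      map_add' := fun a a' => extension_add (hb a) (hb a') hsum hγα.le
      map_smul' := fun c a => extension_smul c a.val }
  exact exists_isExtensionOperator_of_norm_remainder_le T
    (fun a => holomorphic_extension (hb a) hsum hγα.le)
    fun a => norm_remainder_extension_le hsum hγα.le (by positivity) hρ hC₀.le hH.le hlog (hb a)

lemma HasLocalExtensionOperators.uniformBorelSurjective {M : PosSeq}
    (h : HasLocalExtensionOperators M γ) : UniformBorelSurjective M γ := by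
  obtain ⟨c, hc⟩ := h
  intro a ha
  obtain ⟨k, hk⟩ := Set.mem_iUnion.1 ha
  obtain ⟨T, hT⟩ := hc k
  exact ⟨(T ⟨a, hk⟩).val, Set.mem_iUnion.2 ⟨c * k, (T ⟨a, hk⟩).2⟩, hT ⟨a, hk⟩⟩

lemma derivBorelSurjective_of_lt_gammaIndex {M : PosSeq} (hsm : M.ShiftedMoments)
    (hγ : ENNReal.ofReal γ < gammaIndex M) : DerivBorelSurjective M γ := by
  obtain ⟨β, hβ, hγβ, hinc⟩ := ofReal_lt_gammaIndex_iff.1 hγ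
  obtain ⟨δ, hγδ, hδβ⟩ := exists_between hγβ
  lift δ to PosReal using γ.2.trans hγδ
  exact (hasLocalExtensionOperators_of_lt_gammaIndex hsm
    (ofReal_lt_gammaIndex_iff.2 ⟨β, hβ, hδβ, hinc⟩)).uniformBorelSurjective.deriv hγδ

end Ultraholomorphic

theorem theorem3p2_general (M : PosSeq) (hsm : M.ShiftedMoments) :
    (∀ γ : PosReal,
      (ENNReal.ofReal γ < gammaIndex M → HasLocalExtensionOperators M γ) ∧
      (HasLocalExtensionOperators M γ → UniformBorelSurjective M γ) ∧
      (UniformBorelSurjective M γ ↔ Set.Ioc 0 (γ : ℝ) ⊆ uniformSurjInterval M) ∧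
      (UniformBorelSurjective M γ → Set.Ioo 0 (γ : ℝ) ⊆ derivSurjInterval M)) ∧
    {γ : ℝ | 0 < γ ∧ ENNReal.ofReal γ < gammaIndex M} ⊆ derivSurjInterval M ∧
    derivSurjInterval M ⊆ uniformSurjInterval M := by
  refine ⟨fun γ => ⟨hasLocalExtensionOperators_of_lt_gammaIndex hsm,
    HasLocalExtensionOperators.uniformBorelSurjective, ⟨fun hs δ hδ => ?_, fun hsub => ?_⟩,
    fun hs δ hδ => ?_⟩, ?_, ?_⟩
  · exact ⟨hδ.1, hs.mono (δ := ⟨δ, hδ.1⟩) hδ.2⟩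
  · exact (hsub ⟨γ.2, le_rfl⟩).2
  · exact ⟨hδ.1, hs.deriv (δ := ⟨δ, hδ.1⟩) hδ.2⟩
  · rintro γ ⟨hγ, hlt⟩
    exact ⟨hγ, derivBorelSurjective_of_lt_gammaIndex (γ := ⟨γ, hγ⟩) hsm hlt⟩
  · rintro γ ⟨hγ, hs⟩
    exact ⟨hγ, hs.uniform⟩

theorem theorem3p2 (M : PosSeq) (hM : M.IsWeightSequence) (hsm : M.ShiftedMoments)
    (hpos : 0 < gammaIndex M) :
    (∀ γ : PosReal,
      (ENNReal.ofReal γ < gammaIndex M → HasLocalExtensionOperators M γ) ∧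
      (HasLocalExtensionOperators M γ → UniformBorelSurjective M γ) ∧
      (UniformBorelSurjective M γ ↔ Set.Ioc 0 (γ : ℝ) ⊆ uniformSurjInterval M) ∧
      (UniformBorelSurjective M γ → Set.Ioo 0 (γ : ℝ) ⊆ derivSurjInterval M)) ∧
    {γ : ℝ | 0 < γ ∧ ENNReal.ofReal γ < gammaIndex M} ⊆ derivSurjInterval M ∧
    derivSurjInterval M ⊆ uniformSurjInterval M :=
  theorem3p2_general M hsm
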